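/- Let $\Phi:\mathbb R^2\to\mathbb R^2$ be a smooth map with fixed point set $\Sigma=\{x:\Phi(x)=x\}$. Put $\sigma(x,x')=\tfrac12|x'-x|^2$, $S(x)=\sigma(\Phi(x),x)$, $\Psi(x)=\Phi(x)-x$, let $U(t;x,x')=(4\pi t)^{-1}e^{-\sigma(x,x')/(2t)}$ be the heat kernel of the plane, and let $\Theta_\Phi(t)=\int_{\mathbb R^2}U(t;\Phi(x),x)\,dx$ be the deformed heat trace. Assume: 1. $\Sigma$ is a smooth compact connected one-dimensional submanifold of $\mathbb R^2$ without boundary; 2. there are constants $p,R,C>0$ such that $S(x)\ge C\,\sigma(x,0)^p$ whenever $\sigma(x,0)>R^2/2$; 3. $s_2>0$ everywhere on $\Sigma$, where, for a smooth unit normal vector field $h$ along $\Sigma$, $s_k(y)=\partial_z^k S(y+z\,h(y))\big|_{z=0}$ for $y\in\Sigma$. Let $\Psi_{(k)}(y)=\partial_z^k\Psi(y+z\,h(y))\big|_{z=0}$, and let $\kappa:\Sigma\to\mathbb R$ be the function for which the area element in the normal coordinates $x=y+z\,h(y)$ is $(1+z\kappa(y))\,d\mathrm{vol}_\Sigma(y)\,dz$;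 that is, $\kappa=\epsilon_{\alpha\beta}(\nabla_\tau h)^\alpha h^\beta$, where $\tau$ is the unit tangent vector with $(\tau,h)$ positively oriented and $\epsilon_{12}=1$. Let $b_k(y,z)$ be the coefficient of $t^k$ in the formal expansion in powers of $t^{1/2}$ of $$B(t,y,z)=\exp\Big(-\tfrac12\sum_{k\ge3}\frac{t^{k/2-1}}{k!}s_k(y)z^k\Big)\big(1+t^{1/2}z\,\kappa(y)\big),$$ and let $$a_k(y)=\frac1{4\pi}\int_{-\infty}^{\infty}e^{-s_2(y)z^2/4}\,b_k(y,z)\,dz .$$ Then the integrals defining $\Theta_\Phi(t)$ for $t>0$ and $a_k(y)$ converge, the $a_k$ are integrable over $\Sigma$ with respect to arc length, and the $a_k$ are local coefficients of the asymptotic expansion of the deformed heat trace: as $t\to0^+$, $$\Theta_\Phi(t)\sim\sum_{k=0}^\infty t^{(2k-1)/2}\int_\Sigma a_k\,d\mathrm{vol}_\Sigma ,$$ meaning that for every $N\ge 0$ the difference between $\Theta_\Phi(t)$ and the sum over $k<N$ is $O(t^{(2N-1)/2})$. Moreover, everywhere on $\Sigma$, $$a_0=(4\pi s_2)^{-1/2},$$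 $$a_1=(4\pi s_2)^{-1/2}\Big[\big(-s_3\kappa-\tfrac14s_4\big)s_2^{-2}+\tfrac5{12}s_3^2s_2^{-3}\Big],$$ $$a_2=(4\pi s_2)^{-1/2}\Big[\big(-\tfrac12s_5\kappa-\tfrac1{12}s_6\big)s_2^{-3}+\big(\tfrac{35}{12}s_3s_4\kappa+\tfrac7{12}s_3s_5+\tfrac{35}{96}s_4^2\big)s_2^{-4}+\big(-\tfrac{35}{12}s_3^3\kappa-\tfrac{35}{16}s_3^2s_4\big)s_2^{-5}+\tfrac{385}{288}s_3^4s_2^{-6}\Big],$$ where $s_2=\Psi_{(1)}\cdot\Psi_{(1)}$, $s_3=3\,\Psi_{(1)}\cdot\Psi_{(2)}$, $s_4=4\,\Psi_{(1)}\cdot\Psi_{(3)}+3\,\Psi_{(2)}\cdot\Psi_{(2)}$, $s_5=5\,\Psi_{(1)}\cdot\Psi_{(4)}+10\,\Psi_{(2)}\cdot\Psi_{(3)}$, $s_6=6\,\Psi_{(1)}\cdot\Psi_{(5)}+15\,\Psi_{(2)}\cdot\Psi_{(4)}+10\,\Psi_{(3)}\cdot\Psi_{(3)}$. -/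

import Mathlib

open Real Set Filter Topology MeasureTheory
open scoped ContDiff

noncomputable section

namespace DeformedHeat

/-- The Euclidean plane. -/
abbrev Plane : Type := EuclideanSpace ℝ (Fin 2)

/-- The world function `σ(x, x')`: half the squared distance. -/
def worldFunction (x x' : Plane) : ℝ := (1 / 2) * ‖x' - x‖ ^ 2

/-- The heat kernel of the Laplacian on the plane. -/
def heatKernel (t : ℝ) (x x' : Plane) : ℝ :=
  (4 * π * t)⁻¹ * Real.exp (-(worldFunction x x' / (2 * t)))

/-- The deformed heat kernel `U_Φ(t; x, x') = U(t; Φ(x), x')`. -/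
def deformedHeatKernel (Φ : Plane → Plane) (t : ℝ) (x x' : Plane) : ℝ :=
  heatKernel t (Φ x) x'

/-- The deformed heat trace `Θ_Φ(t)`. -/
def deformedHeatTrace (Φ : Plane → Plane) (t : ℝ) : ℝ :=
  ∫ x : Plane, deformedHeatKernel Φ t x x

/-- `S(x) = σ(Φ(x), x)`. -/
def displacement (Φ : Plane → Plane) (x : Plane) : ℝ := worldFunction (Φ x) x

/-- `C` is an embedded smooth one-dimensional submanifold of the plane without boundary: near each
of its points it is the zero set of a smooth function with non-vanishing differential. -/
def IsSmoothCurve (C : Set Plane) : Prop :=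
  ∀ p ∈ C, ∃ U : Set Plane, IsOpen U ∧ p ∈ U ∧ ∃ F : Plane → ℝ,
    ContDiffOn ℝ ∞ F U ∧ (∀ x ∈ U, fderiv ℝ F x ≠ 0) ∧ C ∩ U = {x ∈ U | F x = 0}

/-- `h` is a smooth unit normal vector field along `C`. Smoothness along the submanifold `C` means
that the field is the restriction of a smooth map defined near `C`; only the values of `h` on `C`
enter below. The tangent space of `C` at `y` is `tangentConeAt ℝ C y`. -/
structure IsUnitNormalField (C : Set Plane) (h : Plane → Plane) : Prop where
  smooth : ∃ U : Set Plane, IsOpen U ∧ C ⊆ U ∧ ContDiffOn ℝ ∞ h U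
  unit : ∀ y ∈ C, ‖h y‖ = 1
  normal : ∀ y ∈ C, ∀ v ∈ tangentConeAt ℝ C y, inner ℝ (h y) v = 0

/-- `s_k = ∇_h^k S` on the fixed point set: the `k`-th derivative of `S` along the normal geodesic
`z ↦ y + z h(y)` at `z = 0`. -/
def s (Φ h : Plane → Plane) (k : ℕ) (y : Plane) : ℝ :=
  iteratedDeriv k (fun z : ℝ => displacement Φ (y + z • h y)) 0

/-- `Ψ_(k)`: the `k`-th derivative of `Ψ(x) = Φ(x) - x` along the normal geodesic at `z = 0`. -/
def psi (Φ h : Plane → Plane) (k : ℕ) (y : Plane) : Plane :=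
  iteratedDeriv k (fun z : ℝ => Φ (y + z • h y) - (y + z • h y)) 0

/-- The unit vector `τ` orthogonal to `h(y)` for which `(τ, h(y))` is positively oriented. When `h`
is a unit normal field, it is the unit tangent vector. -/
def tangent (h : Plane → Plane) (y : Plane) : Plane := !₂[h y 1, -(h y 0)]

/-- `κ = ε_{αβ} (∂h^α/∂y) h^β`, with `y` the arc length in the direction `τ`; in the coordinates
`y + z h(y)` the area element is `(1 + z κ) dy dz`. Since `τ` is tangent to the curve, the
derivative depends only on the values of `h` on the curve. -/
def kappa (h : Plane → Plane) (y : Plane) : ℝ :=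
  (fderiv ℝ h y (tangent h y)) 0 * h y 1 - (fderiv ℝ h y (tangent h y)) 1 * h y 0

/-- The formal power series `- (1/2) ∑_{k ≥ 3} s_k z^k / k! · X^(k-2)` in `X = t^(1/2)`. -/
def exponentSeries (Φ h : Plane → Plane) (y : Plane) (z : ℝ) : PowerSeries ℝ :=
  PowerSeries.mk fun n =>
    if n = 0 then 0 else -(1 / 2) * (s Φ h (n + 2) y * z ^ (n + 2) / (Nat.factorial (n + 2) : ℝ))

/-- The expansion of
`B(t, y, z) = exp (- (1/2) ∑_{k ≥ 3} t^(k/2-1) s_k z^k / k!) (1 + t^(1/2) z κ)`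
as a power series in `X = t^(1/2)`. -/
def bSeries (Φ h : Plane → Plane) (y : Plane) (z : ℝ) : PowerSeries ℝ :=
  (PowerSeries.exp ℝ).subst (exponentSeries Φ h y z) *
    (1 + PowerSeries.C (z * kappa h y) * PowerSeries.X)

/-- `b_k`: the coefficient of `t^k = X^(2k)` in `B`. -/
def b (Φ h : Plane → Plane) (k : ℕ) (y : Plane) (z : ℝ) : ℝ :=
  PowerSeries.coeff (2 * k) (bSeries Φ h y z)

/-- The integrand `exp (- s_2 z² / 4) b_k` of the local heat trace coefficient. -/
def aIntegrand (Φ h : Plane → Plane) (k : ℕ) (y : Plane) (z : ℝ) : ℝ :=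
  Real.exp (-(s Φ h 2 y / 4 * z ^ 2)) * b Φ h k y z

/-- The local heat trace coefficient `a_k`. -/
def a (Φ h : Plane → Plane) (k : ℕ) (y : Plane) : ℝ :=
  (4 * π)⁻¹ * ∫ z : ℝ, aIntegrand Φ h k y z

end DeformedHeat

end

/-!
The heat trace is an integral of `exp (-S / (2 t))`, and `S` vanishes exactly on the curve `C`, so
that only a tube around `C` matters as `t → 0`. Off the tube, `S` is bounded below by compactness
and by the growth condition (`exists_displacement_ge`), and the contribution is smaller than every
power of `t` (`isBigO_integral_compl`).

In the tube one passes to normal coordinates `x = y + z h(y)`. The inverse function theorem gives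
charts of `C` (`exists_curveChart`); in a chart the Jacobian is the speed of the parametrization
times `1 + z κ` (`exists_tube_hasFDerivAt`), and integrating the speed yields the one-dimensional
Hausdorff measure (`arcMeasure_eq`), because the parametrization is bi-Lipschitz with almost
matching constants on short arcs. Injectivity of normal coordinates near the compact set `C`
(`exists_injOn_tubeMap`) lets the charts be glued to the change of variables `lintegral_tube`.

There remains Laplace's method on each normal segment, uniformly in `y ∈ C`. With `z = t^(1/2) w`,
the exponent is `-s₂ w² / 4 + w² q(y, z)`, where `q` has a Taylor expansion in `z`, uniform in `y`,
without constant term. Expanding the exponential and then the powers of `q` gives exactly the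
coefficients of the formal series `B`, since these are homogeneous in `(z, X)`
(`exponentSeries_eq_rescale`, `coeff_bSeries`). On segments so short that `|q| ≤ s₂ / 8`, the error
is dominated by a Gaussian (`exists_pointwise_bound`). The odd coefficients integrate to zero, and
the even ones are Gaussian moments, from which the explicit values of `a₀`, `a₁`, `a₂` follow.
-/

/-! ### The formal expansion -/

namespace DeformedHeat

open PowerSeries in
/-- Only finitely many powers of a series without constant term contribute to a given coefficient
of its exponential. -/
theorem coeff_exp_subst {E : PowerSeries ℝ} (hE : constantCoeff E = 0) {n J : ℕ} (hn : n < J) :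
    coeff n ((PowerSeries.exp ℝ).subst E) =
      ∑ j ∈ Finset.range J, ((j.factorial : ℝ))⁻¹ * coeff n (E ^ j) := by
  rw [coeff_subst' (HasSubst.of_constantCoeff_zero' hE), finsum_eq_sum_of_support_subset]
  · refine Finset.sum_congr rfl fun j _ => ?_
    simp [coeff_exp]
  · intro j hj
    simp only [Finset.coe_range, mem_Iio]
    by_contra hjJ
    apply hj
    have : X ^ j ∣ E ^ j := pow_dvd_pow_of_dvd (X_dvd_iff.2 hE) j
    have h0 := (X_pow_dvd_iff.1 this) n (by omega)
    simp [h0]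

/-- The series `e^j (1 + κ X)`, where `e` is the exponent series at `z = 1`. Its coefficients are
the `y`-dependent factors of the polynomials `b_k(y, ·)`. -/
noncomputable def amplitudeSeries (Φ h : Plane → Plane) (j : ℕ) (y : Plane) : PowerSeries ℝ :=
  exponentSeries Φ h y 1 ^ j * (1 + PowerSeries.C (kappa h y) * PowerSeries.X)

theorem constantCoeff_exponentSeries (Φ h : Plane → Plane) (y : Plane) (z : ℝ) :
    PowerSeries.constantCoeff (exponentSeries Φ h y z) = 0 := by
  simp [exponentSeries, ← PowerSeries.coeff_zero_eq_constantCoeff_apply]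

open PowerSeries in
/-- The exponent series is homogeneous: `z` enters only through `z ^ 2` and `z X`. -/
theorem exponentSeries_eq_rescale (Φ h : Plane → Plane) (y : Plane) (z : ℝ) :
    exponentSeries Φ h y z = C (z ^ 2) * rescale z (exponentSeries Φ h y 1) := by
  ext n
  rw [coeff_C_mul, coeff_rescale]
  simp only [exponentSeries, coeff_mk]
  split_ifs
  · simp
  · ring

open PowerSeries in
/-- The coefficients of `B` as polynomials in `z`. Any `J > n` may be used, as
`amplitudeSeries Φ h j y` is divisible by `X ^ j`. -/
theorem coeff_bSeries (Φ h : Plane → Plane) (y : Plane) (z : ℝ) {n J : ℕ} (hn : n < J) :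
    coeff n (bSeries Φ h y z) = ∑ j ∈ Finset.range J,
      ((j.factorial : ℝ))⁻¹ * coeff n (amplitudeSeries Φ h j y) * z ^ (2 * j + n) := by
  set E := exponentSeries Φ h y z with hE
  have hE0 : constantCoeff E = 0 := constantCoeff_exponentSeries Φ h y z
  have hmul : ∀ j : ℕ, E ^ j * (1 + C (z * kappa h y) * X) =
      C (z ^ (2 * j)) * rescale z (amplitudeSeries Φ h j y) := by
    intro j
    have hX : C (z * kappa h y) * X = rescale z (C (kappa h y) * X) := by
      ext m
      rw [coeff_rescale, coeff_C_mul, coeff_C_mul, coeff_X]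
      split_ifs with hm
      · subst hm; ring
      · ring
    have h1 : (1 : PowerSeries ℝ) + rescale z (C (kappa h y) * X) =
        rescale z (1 + C (kappa h y) * X) := by rw [map_add, map_one]
    rw [hE, exponentSeries_eq_rescale, hX, h1, amplitudeSeries, mul_pow, ← map_pow, ← map_pow,
      ← pow_mul, map_mul, mul_assoc]
  have key : ∀ n < J, coeff n ((PowerSeries.exp ℝ).subst E) =
      coeff n (∑ j ∈ Finset.range J, C ((j.factorial : ℝ))⁻¹ * E ^ j) := by
    intro n hn
    rw [coeff_exp_subst hE0 hn, map_sum]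
    simp only [coeff_C_mul]
  have : coeff n (bSeries Φ h y z) =
      coeff n ((∑ j ∈ Finset.range J, C ((j.factorial : ℝ))⁻¹ * E ^ j) *
        (1 + C (z * kappa h y) * X)) := by
    rw [bSeries, coeff_mul, coeff_mul]
    refine Finset.sum_congr rfl fun p hp => ?_
    have := Finset.HasAntidiagonal.mem_antidiagonal.1 hp
    rw [key p.1 (by omega)]
  rw [this, Finset.sum_mul, map_sum]
  refine Finset.sum_congr rfl fun j _ => ?_
  rw [mul_assoc, hmul, coeff_C_mul, coeff_C_mul, coeff_rescale]
  ring

/-! ### Gaussian moments -/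

theorem integrable_pow_mul_exp_neg_mul_sq {c : ℝ} (hc : 0 < c) (n : ℕ) :
    Integrable fun z : ℝ => z ^ n * Real.exp (-(c * z ^ 2)) := by
  have := integrable_rpow_mul_exp_neg_mul_sq hc (s := n) (by linarith [n.cast_nonneg (α := ℝ)])
  simpa [neg_mul] using this

theorem integrable_abs_pow_mul_exp_neg_mul_sq {c : ℝ} (hc : 0 < c) (n : ℕ) :
    Integrable fun z : ℝ => |z| ^ n * Real.exp (-(c * z ^ 2)) := by
  refine (integrable_pow_mul_exp_neg_mul_sq hc n).abs.congr (ae_of_all _ fun z => ?_)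
  simp [abs_mul, abs_pow]

theorem integral_odd_pow_mul_exp (c : ℝ) {n : ℕ} (hn : Odd n) :
    ∫ z : ℝ, z ^ n * Real.exp (-(c * z ^ 2)) = 0 := by
  have h := integral_neg_eq_self (fun z : ℝ => z ^ n * Real.exp (-(c * z ^ 2))) volume
  have h2 : (fun z : ℝ => (-z) ^ n * Real.exp (-(c * (-z) ^ 2))) =
      fun z => -(z ^ n * Real.exp (-(c * z ^ 2))) := by
    ext z; rw [hn.neg_pow, neg_sq, neg_mul]
  rw [h2, integral_neg] at h
  linarith

open scoped Nat in
theorem integral_even_pow_mul_exp {s : ℝ} (hs : 0 < s) (m : ℕ) :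
    ∫ z : ℝ, z ^ (2 * m) * Real.exp (-(s / 4 * z ^ 2)) =
      4 * π * ((4 * π * s) ^ (-(1 / 2) : ℝ) * ((2 * m - 1 : ℕ)‼ * (2 / s) ^ m)) := by
  have habs : (fun z : ℝ => z ^ (2 * m) * Real.exp (-(s / 4 * z ^ 2))) =
      fun z => (fun x : ℝ => x ^ (2 * m) * Real.exp (-(s / 4 * x ^ 2))) |z| := by
    ext z; simp [pow_mul]
  rw [habs, integral_comp_abs (f := fun x : ℝ => x ^ (2 * m) * Real.exp (-(s / 4 * x ^ 2)))]
  have h1 := integral_rpow_mul_exp_neg_mul_rpow (p := 2) (q := (2 * m : ℕ)) (b := s / 4) two_pos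
    (by linarith [(2 * m).cast_nonneg (α := ℝ)]) (by positivity)
  have h2 : ∫ x in Ioi (0 : ℝ), x ^ (2 * m) * Real.exp (-(s / 4 * x ^ 2)) =
      ∫ x in Ioi (0 : ℝ), x ^ (((2 * m : ℕ)) : ℝ) * Real.exp (-(s / 4) * x ^ (2 : ℝ)) := by
    simp only [Real.rpow_natCast, Real.rpow_two, neg_mul]
  have e1 : (((2 * m : ℕ) : ℝ) + 1) / 2 = m + 1 / 2 := by push_cast; ring
  have e2 : -(((2 * m : ℕ) : ℝ) + 1) / 2 = -(1 / 2) + -(m : ℝ) := by push_cast; ring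
  rw [h2, h1, e1, e2, Real.Gamma_nat_add_half, Real.rpow_add (by positivity), Real.rpow_neg
    (by positivity) (m : ℝ), Real.rpow_natCast]
  have e3 : (4 * π * s) ^ (-(1 / 2) : ℝ) = (s / 4) ^ (-(1 / 2) : ℝ) * (4 * √π)⁻¹ := by
    have : 4 * π * s = s / 4 * (4 * √π) ^ 2 := by
      rw [mul_pow, Real.sq_sqrt pi_pos.le]; ring
    rw [this, Real.mul_rpow (by positivity) (by positivity), ← Real.rpow_natCast (4 * √π),
      ← Real.rpow_mul (by positivity)]
    norm_num [Real.rpow_neg_one]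
  rw [e3]
  have e4 : 4 * π = 4 * (√π * √π) := by rw [Real.mul_self_sqrt pi_pos.le]
  rw [e4]
  have : √π ≠ 0 := (Real.sqrt_pos.2 pi_pos).ne'
  rw [div_pow, div_pow]
  have h4 : (4 : ℝ) ^ m = 2 ^ m * 2 ^ m := by rw [← mul_pow]; norm_num
  rw [h4]
  field_simp

/-! ### The local coefficients -/

theorem aIntegrand_eq_sum (Φ h : Plane → Plane) (k : ℕ) (y : Plane) {J : ℕ} (hJ : 2 * k < J) :
    aIntegrand Φ h k y = fun z => ∑ j ∈ Finset.range J,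
      ((j.factorial : ℝ))⁻¹ * PowerSeries.coeff (2 * k) (amplitudeSeries Φ h j y) *
        (z ^ (2 * (j + k)) * Real.exp (-(s Φ h 2 y / 4 * z ^ 2))) := by
  ext z
  rw [aIntegrand, b, coeff_bSeries Φ h y z hJ, Finset.mul_sum]
  refine Finset.sum_congr rfl fun j _ => ?_
  rw [show 2 * j + 2 * k = 2 * (j + k) by ring]
  ring

theorem integrable_aIntegrand {Φ h : Plane → Plane} {y : Plane} (hs : 0 < s Φ h 2 y) (k : ℕ) :
    Integrable (aIntegrand Φ h k y) := by
  rw [aIntegrand_eq_sum Φ h k y (Nat.lt_succ_self _)]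
  refine integrable_finsetSum _ fun j _ => ?_
  exact (integrable_pow_mul_exp_neg_mul_sq (by positivity) _).const_mul _

open scoped Nat in
theorem a_eq_sum {Φ h : Plane → Plane} {y : Plane} (hs : 0 < s Φ h 2 y) {k J : ℕ}
    (hJ : 2 * k < J) :
    a Φ h k y = (4 * π * s Φ h 2 y) ^ (-(1 / 2) : ℝ) * ∑ j ∈ Finset.range J,
      ((j.factorial : ℝ))⁻¹ * PowerSeries.coeff (2 * k) (amplitudeSeries Φ h j y) *
        ((2 * (j + k) - 1 : ℕ)‼ * (2 / s Φ h 2 y) ^ (j + k)) := by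
  rw [a, aIntegrand_eq_sum Φ h k y hJ, integral_finsetSum, Finset.mul_sum, Finset.mul_sum]
  · refine Finset.sum_congr rfl fun j _ => ?_
    rw [integral_const_mul, integral_even_pow_mul_exp hs]
    have := pi_pos.ne'
    field_simp
  · intro j _
    exact (integrable_pow_mul_exp_neg_mul_sq (by positivity) _).const_mul _

open PowerSeries in
theorem coeff_mul_one_add_C_mul_X (f : PowerSeries ℝ) (c : ℝ) (n : ℕ) :
    coeff (n + 1) (f * (1 + C c * X)) = coeff (n + 1) f + c * coeff n f := by
  rw [mul_add, mul_one, map_add, ← mul_assoc, coeff_succ_mul_X, mul_comm f, coeff_C_mul]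

theorem a_zero_eq {Φ h : Plane → Plane} {y : Plane} (hs : 0 < s Φ h 2 y) :
    a Φ h 0 y = (4 * π * s Φ h 2 y) ^ (-(1 / 2) : ℝ) := by
  rw [a_eq_sum hs (J := 1) (by norm_num)]
  simp [amplitudeSeries]

theorem coeff_exponentSeries_one (Φ h : Plane → Plane) (y : Plane) (n : ℕ) :
    PowerSeries.coeff (n + 1) (exponentSeries Φ h y 1) =
      -(1 / 2) * (s Φ h (n + 3) y / ((n + 3).factorial : ℝ)) := by
  simp [exponentSeries]

section LowCoefficients

open PowerSeries

variable {f : PowerSeries ℝ}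

theorem coeff_pow_of_lt (hf : constantCoeff f = 0) {j n : ℕ} (hn : n < j) :
    coeff n (f ^ j) = 0 :=
  X_pow_dvd_iff.1 (pow_dvd_pow_of_dvd (X_dvd_iff.2 hf) j) n hn

theorem coeff_pow_succ_self (hf : constantCoeff f = 0) (j : ℕ) :
    coeff j (f ^ j) = coeff 1 f ^ j := by
  obtain ⟨g, rfl⟩ := X_dvd_iff.2 hf
  rw [mul_pow]
  have h1 := coeff_X_pow_mul (g ^ j) j 0
  have h2 := coeff_X_pow_mul g 1 0
  simp only [zero_add, pow_one] at h1 h2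
  rw [h1, h2]
  simp

theorem coeff_three_sq (hf : constantCoeff f = 0) :
    coeff 3 (f ^ 2) = 2 * coeff 1 f * coeff 2 f := by
  rw [pow_two, coeff_mul]
  simp [Finset.Nat.antidiagonal_succ, hf]
  ring

theorem coeff_four_sq (hf : constantCoeff f = 0) :
    coeff 4 (f ^ 2) = 2 * coeff 1 f * coeff 3 f + coeff 2 f ^ 2 := by
  rw [pow_two, coeff_mul]
  simp [Finset.Nat.antidiagonal_succ, hf]
  ring

theorem coeff_four_cube (hf : constantCoeff f = 0) :
    coeff 4 (f ^ 3) = 3 * coeff 1 f ^ 2 * coeff 2 f := by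
  have h3 := coeff_three_sq hf
  have h2 := coeff_pow_succ_self hf 2
  have h1 : coeff 1 (f ^ 2) = 0 := coeff_pow_of_lt hf (by norm_num)
  have h0 : constantCoeff (f ^ 2) = 0 := by simp [hf]
  rw [pow_succ, coeff_mul]
  simp only [Finset.Nat.antidiagonal_succ, Finset.Nat.antidiagonal_zero, Finset.map_singleton,
    Finset.map_cons, Finset.sum_cons, Finset.sum_singleton, Function.Embedding.prodMap,
    Function.Embedding.coeFn_mk, Prod.map, Nat.succ_eq_add_one, Function.Embedding.refl_apply]
  simp [h0, h1, h2, h3, hf]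
  ring

end LowCoefficients

theorem a_one_eq {Φ h : Plane → Plane} {y : Plane} (hs : 0 < s Φ h 2 y) :
    a Φ h 1 y = (4 * π * s Φ h 2 y) ^ (-(1 / 2) : ℝ) *
      ((-(s Φ h 3 y * kappa h y) - 1 / 4 * s Φ h 4 y) * s Φ h 2 y ^ (-2 : ℤ)
        + 5 / 12 * s Φ h 3 y ^ 2 * s Φ h 2 y ^ (-3 : ℤ)) := by
  have h0 := constantCoeff_exponentSeries Φ h y 1
  have c1 := coeff_exponentSeries_one Φ h y 0
  have c2 := coeff_exponentSeries_one Φ h y 1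
  norm_num at c1 c2
  have p21 := coeff_pow_of_lt h0 (j := 2) (n := 1) (by norm_num)
  have p22 := coeff_pow_succ_self h0 2
  rw [a_eq_sum hs (J := 3) (by norm_num)]
  congr 1
  simp only [Finset.sum_range_succ, Finset.sum_range_zero, amplitudeSeries,
    coeff_mul_one_add_C_mul_X, mul_one, pow_zero, pow_one, p21, p22, c1, c2]
  simp only [PowerSeries.coeff_one]
  norm_num [Nat.factorial, Nat.doubleFactorial, zpow_neg]
  field_simp
  ring

theorem a_two_eq {Φ h : Plane → Plane} {y : Plane} (hs : 0 < s Φ h 2 y) :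
    a Φ h 2 y = (4 * π * s Φ h 2 y) ^ (-(1 / 2) : ℝ) *
      ((-(1 / 2 * s Φ h 5 y * kappa h y) - 1 / 12 * s Φ h 6 y) * s Φ h 2 y ^ (-3 : ℤ)
        + (35 / 12 * s Φ h 3 y * s Φ h 4 y * kappa h y + 7 / 12 * s Φ h 3 y * s Φ h 5 y
          + 35 / 96 * s Φ h 4 y ^ 2) * s Φ h 2 y ^ (-4 : ℤ)
        + (-(35 / 12 * s Φ h 3 y ^ 3 * kappa h y) - 35 / 16 * s Φ h 3 y ^ 2 * s Φ h 4 y)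
          * s Φ h 2 y ^ (-5 : ℤ)
        + 385 / 288 * s Φ h 3 y ^ 4 * s Φ h 2 y ^ (-6 : ℤ)) := by
  have h0 := constantCoeff_exponentSeries Φ h y 1
  have c1 := coeff_exponentSeries_one Φ h y 0
  have c2 := coeff_exponentSeries_one Φ h y 1
  have c3 := coeff_exponentSeries_one Φ h y 2
  have c4 := coeff_exponentSeries_one Φ h y 3
  norm_num at c1 c2 c3 c4
  have p23 := coeff_three_sq h0
  have p24 := coeff_four_sq h0
  have p33 := coeff_pow_succ_self h0 3
  have p34 := coeff_four_cube h0
  have p43 := coeff_pow_of_lt h0 (j := 4) (n := 3) (by norm_num)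
  have p44 := coeff_pow_succ_self h0 4
  rw [a_eq_sum hs (J := 5) (by norm_num)]
  congr 1
  simp only [Finset.sum_range_succ, Finset.sum_range_zero, amplitudeSeries,
    coeff_mul_one_add_C_mul_X, pow_zero, pow_one, p23, p24, p33, p34, p43, p44,
    c1, c2, c3, c4]
  simp only [PowerSeries.coeff_one]
  norm_num [Nat.factorial, Nat.doubleFactorial, zpow_neg]
  field_simp
  ring

/-! ### The normal derivatives of the displacement -/

/-- Leibniz' rule for the square of the norm along a curve. -/
theorem iteratedDeriv_inner_self {f : ℝ → Plane} (hf : ContDiff ℝ ∞ f) (k : ℕ) (x : ℝ) :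
    iteratedDeriv k (fun z => inner ℝ (f z) (f z)) x = ∑ i ∈ Finset.range (k + 1),
      (k.choose i : ℝ) * inner ℝ (iteratedDeriv i f x) (iteratedDeriv (k - i) f x) := by
  have hcoord : ∀ (i : Fin 2) (k : ℕ) (x : ℝ),
      iteratedDeriv k (fun z => f z i) x = iteratedDeriv k f x i := by
    intro i k
    induction k with
    | zero => simp
    | succ k ih =>
      intro x
      have hd : HasDerivAt (iteratedDeriv k f) (iteratedDeriv (k + 1) f x) x := by
        rw [iteratedDeriv_succ]
        exact (hf.differentiable_iteratedDeriv k (by exact_mod_cast WithTop.coe_lt_top _)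
          x).hasDerivAt
      rw [iteratedDeriv_succ, funext ih]
      exact ((EuclideanSpace.proj (𝕜 := ℝ) i).hasFDerivAt.comp_hasDerivAt x hd).deriv
  have hfi : ∀ i : Fin 2, ContDiff ℝ ∞ fun z => f z i := fun i =>
    (EuclideanSpace.proj (𝕜 := ℝ) i).contDiff.comp hf
  have hk : ∀ i : Fin 2, ContDiffAt ℝ k (fun z => f z i) x := fun i =>
    ((hfi i).of_le (by exact_mod_cast le_top)).contDiffAt
  have h1 : (fun z => inner ℝ (f z) (f z)) = fun z => f z 0 * f z 0 + f z 1 * f z 1 := by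
    ext z
    simp only [PiLp.inner_apply, Fin.sum_univ_two]
    simp [pow_two]
  rw [h1, iteratedDeriv_fun_add ((hk 0).mul (hk 0)) ((hk 1).mul (hk 1)),
    iteratedDeriv_fun_mul (hk 0) (hk 0), iteratedDeriv_fun_mul (hk 1) (hk 1),
    ← Finset.sum_add_distrib]
  refine Finset.sum_congr rfl fun i _ => ?_
  simp only [hcoord, PiLp.inner_apply, Fin.sum_univ_two]
  simp
  ring

theorem displacement_eq (Φ : Plane → Plane) (x : Plane) :
    displacement Φ x = (1 / 2) * inner ℝ (Φ x - x) (Φ x - x) := by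
  rw [displacement, worldFunction, real_inner_self_eq_norm_sq, norm_sub_rev]

theorem s_eq_sum {Φ h : Plane → Plane} (hΦ : ContDiff ℝ ∞ Φ) (k : ℕ) (y : Plane) :
    s Φ h k y = (1 / 2) * ∑ i ∈ Finset.range (k + 1),
      (k.choose i : ℝ) * inner ℝ (psi Φ h i y) (psi Φ h (k - i) y) := by
  have hf : ContDiff ℝ ∞ fun z : ℝ => Φ (y + z • h y) - (y + z • h y) := by fun_prop
  simp only [psi]
  rw [← iteratedDeriv_inner_self hf, s]
  simp only [displacement_eq]
  rw [iteratedDeriv_const_mul_field]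

theorem psi_zero {Φ h : Plane → Plane} {y : Plane} (hy : y ∈ Function.fixedPoints Φ) :
    psi Φ h 0 y = 0 := by
  simp [psi, hy.eq]

/-- Leibniz' rule at a fixed point, where `Ψ` vanishes. -/
theorem s_explicit {Φ h : Plane → Plane} (hΦ : ContDiff ℝ ∞ Φ) {y : Plane}
    (hy : y ∈ Function.fixedPoints Φ) {ψ : ℕ → Plane} (hψ : ∀ k, ψ k = psi Φ h k y) :
    s Φ h 2 y = inner ℝ (ψ 1) (ψ 1) ∧
    s Φ h 3 y = 3 * inner ℝ (ψ 1) (ψ 2) ∧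
    s Φ h 4 y = 4 * inner ℝ (ψ 1) (ψ 3) + 3 * inner ℝ (ψ 2) (ψ 2) ∧
    s Φ h 5 y = 5 * inner ℝ (ψ 1) (ψ 4) + 10 * inner ℝ (ψ 2) (ψ 3) ∧
    s Φ h 6 y = 6 * inner ℝ (ψ 1) (ψ 5) + 15 * inner ℝ (ψ 2) (ψ 4)
      + 10 * inner ℝ (ψ 3) (ψ 3) := by
  have h0 : ψ 0 = 0 := (hψ 0).trans (psi_zero hy)
  simp only [s_eq_sum hΦ, ← hψ, Finset.sum_range_succ, Finset.sum_range_zero, h0,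
    inner_zero_left, inner_zero_right, Nat.sub_self, Nat.reduceSub, Nat.choose, Nat.sub_zero]
  rw [real_inner_comm (ψ 1) (ψ 2), real_inner_comm (ψ 1) (ψ 3), real_inner_comm (ψ 1) (ψ 4),
    real_inner_comm (ψ 1) (ψ 5), real_inner_comm (ψ 2) (ψ 3), real_inner_comm (ψ 2) (ψ 4)]
  refine ⟨?_, ?_, ?_, ?_, ?_⟩ <;> norm_num <;> ring

/-! ### Taylor expansions uniform in a parameter -/

/-- On `|z| ≤ δ` and uniformly in `y ∈ C`, the function `f y` has the Taylor series `p y` at `0`,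
to every order. -/
def HasUniformExpansion {α : Type*} (C : Set α) (δ : ℝ) (f : α → ℝ → ℝ) (p : α → PowerSeries ℝ) :
    Prop :=
  ∀ M : ℕ, ∃ c : ℝ, 0 ≤ c ∧ ∀ y ∈ C, ∀ z : ℝ, |z| ≤ δ →
    |f y z - ∑ n ∈ Finset.range M, PowerSeries.coeff n (p y) * z ^ n| ≤ c * |z| ^ M

namespace HasUniformExpansion

variable {α : Type*} {C : Set α} {δ : ℝ} {f g : α → ℝ → ℝ} {p q : α → PowerSeries ℝ}

theorem bounded (hf : HasUniformExpansion C δ f p) :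
    ∃ c, 0 ≤ c ∧ ∀ y ∈ C, ∀ z : ℝ, |z| ≤ δ → |f y z| ≤ c := by
  obtain ⟨c, hc, H⟩ := hf 0
  exact ⟨c, hc, fun y hy z hz => by simpa using H y hy z hz⟩

theorem coeff_bounded (hδ : 0 < δ) (hf : HasUniformExpansion C δ f p) (n : ℕ) :
    ∃ c, 0 ≤ c ∧ ∀ y ∈ C, |PowerSeries.coeff n (p y)| ≤ c := by
  obtain ⟨c₁, hc₁, H₁⟩ := hf n
  obtain ⟨c₂, hc₂, H₂⟩ := hf (n + 1)
  refine ⟨(c₁ * |δ| ^ n + c₂ * |δ| ^ (n + 1)) / δ ^ n, by positivity, fun y hy => ?_⟩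
  have h1 := H₁ y hy δ (abs_of_pos hδ).le
  have h2 := H₂ y hy δ (abs_of_pos hδ).le
  rw [le_div_iff₀ (by positivity), ← abs_of_pos (pow_pos hδ n), ← abs_mul]
  rw [Finset.sum_range_succ] at h2
  rw [abs_le] at h1 h2 ⊢
  constructor <;> linarith [h1.1, h1.2, h2.1, h2.2]

/-- The `M`-th partial sum of `p q` is `∑_j q_j z^j T_{M-j} p`, so that the error of a product is
controlled by the errors of the factors at all lower orders. -/
theorem mul (hδ : 0 < δ) (hf : HasUniformExpansion C δ f p) (hg : HasUniformExpansion C δ g q) :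
    HasUniformExpansion C δ (fun y z => f y z * g y z) (fun y => p y * q y) := by
  intro M
  obtain ⟨b, hb, hfb⟩ := hf.bounded
  obtain ⟨c, hc, hgc⟩ := hg M
  choose d hd hfd using hf
  choose e he hqe using hg.coeff_bounded hδ
  refine ⟨b * c + ∑ j ∈ Finset.range M, e j * d (M - j),
    add_nonneg (mul_nonneg hb hc) (Finset.sum_nonneg fun j _ => mul_nonneg (he j) (hd _)),
    fun y hy z hz => ?_⟩
  have hsum : ∑ n ∈ Finset.range M, PowerSeries.coeff n (p y * q y) * z ^ n =
      ∑ j ∈ Finset.range M, PowerSeries.coeff j (q y) * z ^ j *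
        ∑ k ∈ Finset.range (M - j), PowerSeries.coeff k (p y) * z ^ k := by
    simp only [Finset.mul_sum]
    rw [← Finset.sum_range_diag_flip M fun j k =>
      PowerSeries.coeff j (q y) * z ^ j * (PowerSeries.coeff k (p y) * z ^ k)]
    refine Finset.sum_congr rfl fun n _ => ?_
    rw [mul_comm (p y), PowerSeries.coeff_mul, Finset.Nat.sum_antidiagonal_eq_sum_range_succ
      (fun i j => PowerSeries.coeff i (q y) * PowerSeries.coeff j (p y)), Finset.sum_mul]
    refine Finset.sum_congr rfl fun j hj => ?_
    have hjn : j ≤ n := Nat.lt_succ_iff.1 (Finset.mem_range.1 hj)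
    rw [← pow_mul_pow_sub z hjn]; ring
  have hsplit : f y z * g y z - ∑ n ∈ Finset.range M, PowerSeries.coeff n (p y * q y) * z ^ n =
      f y z * (g y z - ∑ n ∈ Finset.range M, PowerSeries.coeff n (q y) * z ^ n) +
      ∑ j ∈ Finset.range M, PowerSeries.coeff j (q y) * z ^ j *
        (f y z - ∑ k ∈ Finset.range (M - j), PowerSeries.coeff k (p y) * z ^ k) := by
    rw [hsum]
    simp only [mul_sub, Finset.sum_sub_distrib, Finset.mul_sum]
    simp only [mul_comm (f y z)]
    ring
  simp only
  rw [hsplit]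
  refine (abs_add_le _ _).trans ?_
  rw [add_mul, abs_mul, Finset.sum_mul]
  refine add_le_add ?_ ((Finset.abs_sum_le_sum_abs _ _).trans (Finset.sum_le_sum fun j hj => ?_))
  · rw [mul_assoc]
    exact mul_le_mul (hfb y hy z hz) (hgc y hy z hz) (abs_nonneg _) hb
  · have hjM : j ≤ M := (Finset.mem_range.1 hj).le
    calc |PowerSeries.coeff j (q y) * z ^ j *
          (f y z - ∑ k ∈ Finset.range (M - j), PowerSeries.coeff k (p y) * z ^ k)|
        ≤ (e j * |z| ^ j) * (d (M - j) * |z| ^ (M - j)) := by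
          rw [abs_mul, abs_mul, abs_pow]
          exact mul_le_mul (mul_le_mul_of_nonneg_right (hqe j y hy) (by positivity))
            (hfd _ y hy z hz) (abs_nonneg _) (mul_nonneg (he j) (by positivity))
      _ = e j * d (M - j) * |z| ^ M := by
          rw [← pow_mul_pow_sub |z| hjM]; ring

theorem one_add_mul (κ : α → ℝ) {c : ℝ} (hκ : ∀ y ∈ C, |κ y| ≤ c) :
    HasUniformExpansion C δ (fun y z => 1 + κ y * z)
      (fun y => 1 + PowerSeries.C (κ y) * PowerSeries.X) := by
  have hcoeff : ∀ y n, PowerSeries.coeff (n + 2)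
      (1 + PowerSeries.C (κ y) * PowerSeries.X : PowerSeries ℝ) = 0 := by
    intro y n
    rw [map_add, PowerSeries.coeff_C_mul, PowerSeries.coeff_X, PowerSeries.coeff_one]
    simp
  intro M
  match M with
  | 0 =>
    refine ⟨1 + |c| * |δ|, by positivity, fun y hy z hz => ?_⟩
    simp only [Finset.range_zero, Finset.sum_empty, sub_zero, pow_zero, mul_one]
    refine (abs_add_le _ _).trans ?_
    rw [abs_one, abs_mul]
    have := mul_le_mul ((hκ y hy).trans (le_abs_self c)) (hz.trans (le_abs_self δ)) (abs_nonneg _)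
      (abs_nonneg _)
    linarith
  | 1 =>
    refine ⟨|c|, by positivity, fun y hy z hz => ?_⟩
    simp only [Finset.range_one, Finset.sum_singleton, pow_zero, mul_one, pow_one]
    have : PowerSeries.coeff 0 (1 + PowerSeries.C (κ y) * PowerSeries.X : PowerSeries ℝ) = 1 := by
      simp
    rw [this, add_sub_cancel_left, abs_mul]
    exact mul_le_mul_of_nonneg_right ((hκ y hy).trans (le_abs_self c)) (abs_nonneg _)
  | M + 2 =>
    refine ⟨0, le_rfl, fun y hy z hz => ?_⟩
    rw [Finset.sum_range_succ', Finset.sum_range_succ']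
    simp only [add_assoc, Nat.reduceAdd, hcoeff]
    simp [add_comm]

theorem pow (hδ : 0 < δ) (hf : HasUniformExpansion C δ f p) (j : ℕ) :
    HasUniformExpansion C δ (fun y z => f y z ^ j) (fun y => p y ^ j) := by
  induction j with
  | zero => simpa using one_add_mul (C := C) (δ := δ) (fun _ => 0) (c := 0) (by simp)
  | succ j ih => simpa only [pow_succ] using ih.mul hδ hf

end HasUniformExpansion

/-- Taylor's inequality at `0`, on both sides of the base point. -/
theorem abs_sub_taylor_le {δ : ℝ} (n : ℕ) {f : ℝ → ℝ} (hf : ContDiff ℝ ∞ f) {c : ℝ}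
    (H : ∀ z, |z| ≤ δ → |iteratedDeriv n f z| ≤ c) (z : ℝ) (hz : |z| ≤ δ) :
    |f z - ∑ k ∈ Finset.range n, iteratedDeriv k f 0 / (k.factorial : ℝ) * z ^ k| ≤
      c * |z| ^ n := by
  induction n generalizing f z with
  | zero => simpa using H z hz
  | succ n ih =>
    have hf' : ContDiff ℝ ∞ (deriv f) := by
      have := hf.iterate_deriv 1
      simpa using this
    have hd : ∀ k, iteratedDeriv k (deriv f) = iteratedDeriv (k + 1) f := fun k =>
      iteratedDeriv_succ'.symm
    have ih' := ih hf' (by simpa only [hd] using H)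
    set T : ℝ → ℝ := fun z =>
      ∑ k ∈ Finset.range (n + 1), iteratedDeriv k f 0 / (k.factorial : ℝ) * z ^ k with hT
    have hTd : ∀ x, HasDerivAt T
        (∑ k ∈ Finset.range n, iteratedDeriv k (deriv f) 0 / (k.factorial : ℝ) * x ^ k) x := by
      intro x
      have h1 : HasDerivAt T (∑ k ∈ Finset.range (n + 1),
          iteratedDeriv k f 0 / (k.factorial : ℝ) * (k * x ^ (k - 1))) x :=
        HasDerivAt.fun_sum fun k _ => (hasDerivAt_pow k x).const_mul _
      convert! h1 using 1
      rw [Finset.sum_range_succ']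
      simp only [hd, Nat.cast_zero, zero_mul, mul_zero, add_zero]
      refine Finset.sum_congr rfl fun k _ => ?_
      rw [Nat.factorial_succ]
      push_cast
      have : (k.factorial : ℝ) ≠ 0 := by positivity
      field_simp
    have hfd : ∀ x, HasDerivAt f (deriv f x) x := fun x =>
      ((hf.differentiable (by norm_num)) x).hasDerivAt
    have key := (convex_Icc (-|z|) |z|).norm_image_sub_le_of_norm_hasDerivWithin_le
      (f := fun x => f x - T x) (C := c * |z| ^ n)
      (fun x _ => ((hfd x).sub (hTd x)).hasDerivWithinAt) (fun x hx => ?_)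
      (x := 0) (y := z) (by simp) ⟨neg_abs_le z, le_abs_self z⟩
    · have hT0 : T 0 = f 0 := by
        simp [hT, Finset.sum_range_succ']
      simp only [hT0, sub_self, sub_zero, Real.norm_eq_abs] at key
      rw [pow_succ, ← mul_assoc]
      exact key
    · have hxz : |x| ≤ |z| := abs_le.2 hx
      have h0 := ih' x (hxz.trans hz)
      have hc : 0 ≤ c := (abs_nonneg _).trans (H z hz)
      exact h0.trans (mul_le_mul_of_nonneg_left (pow_le_pow_left₀ (abs_nonneg _) hxz n) hc)

/-- The derivatives of a smooth function along a line depend smoothly on the point and the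
direction. -/
theorem exists_contDiff_iteratedDeriv_line {S : Plane → ℝ} (hS : ContDiff ℝ ∞ S) (k : ℕ) :
    ∃ G : Plane × Plane → ℝ, ContDiff ℝ ∞ G ∧ ∀ (x v : Plane) (z : ℝ),
      iteratedDeriv k (fun z : ℝ => S (x + z • v)) z = G (x + z • v, v) := by
  induction k with
  | zero => exact ⟨fun q => S q.1, hS.comp contDiff_fst, fun x v z => by simp⟩
  | succ k ih =>
    obtain ⟨G, hG, H⟩ := ih
    refine ⟨fun q => fderiv ℝ G q (q.2, 0), ?_, fun x v z => ?_⟩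
    · exact (hG.fderiv_right (m := ∞) (by norm_num)).clm_apply (contDiff_snd.prodMk contDiff_const)
    · rw [iteratedDeriv_succ, funext (H x v)]
      have h1 : HasDerivAt (fun z : ℝ => (x + z • v, v)) (v, (0 : Plane)) z := by
        refine HasDerivAt.prodMk ?_ (hasDerivAt_const _ _)
        simpa using ((hasDerivAt_id z).smul_const v).const_add x
      have h2 := (hG.differentiable (by norm_num) (x + z • v, v)).hasFDerivAt
      exact (h2.comp_hasDerivAt z h1).deriv

theorem contDiff_displacement {Φ : Plane → Plane} (hΦ : ContDiff ℝ ∞ Φ) :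
    ContDiff ℝ ∞ (displacement Φ) := by
  have : displacement Φ = fun x => (1 / 2) * inner ℝ (Φ x - x) (Φ x - x) :=
    funext (displacement_eq Φ)
  rw [this]
  exact contDiff_const.mul ((hΦ.sub contDiff_id).inner ℝ (hΦ.sub contDiff_id))

section

variable {Φ h : Plane → Plane} {C : Set Plane}

theorem continuousOn_s (hΦ : ContDiff ℝ ∞ Φ) (hh : ContinuousOn h C) (k : ℕ) :
    ContinuousOn (s Φ h k) C := by
  obtain ⟨G, hG, H⟩ := exists_contDiff_iteratedDeriv_line (contDiff_displacement hΦ) k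
  have : s Φ h k = fun y => G (y + (0 : ℝ) • h y, h y) := funext fun y => H y (h y) 0
  rw [this]
  refine hG.continuous.comp_continuousOn ?_
  fun_prop

theorem s_zero_eq {y : Plane} (hΦ : ContDiff ℝ ∞ Φ) (hy : y ∈ Function.fixedPoints Φ) :
    s Φ h 0 y = 0 := by
  simp [s_eq_sum hΦ, psi_zero hy]

theorem s_one_eq {y : Plane} (hΦ : ContDiff ℝ ∞ Φ) (hy : y ∈ Function.fixedPoints Φ) :
    s Φ h 1 y = 0 := by
  simp [s_eq_sum hΦ, psi_zero hy, Finset.sum_range_succ]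

/-- `-(S - s₂ z² / 2) / (2 z²)`, the part of the exponent which is of higher order in `z`. Its value
at `z = 0` is `0`, by the convention for division by zero, which is the continuous extension. -/
noncomputable def exponentRemainder (Φ h : Plane → Plane) (y : Plane) (z : ℝ) : ℝ :=
  -(displacement Φ (y + z • h y) - s Φ h 2 y / 2 * z ^ 2) / (2 * z ^ 2)

theorem hasUniformExpansion_exponentRemainder (hΦ : ContDiff ℝ ∞ Φ) (hC : IsCompact C)
    (hfix : C ⊆ Function.fixedPoints Φ) (hh : ContinuousOn h C) (δ : ℝ) :
    HasUniformExpansion C δ (exponentRemainder Φ h) (fun y => exponentSeries Φ h y 1) := by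
  have hsucc : ∀ M : ℕ, ∃ c : ℝ, 0 ≤ c ∧ ∀ y ∈ C, ∀ z : ℝ, |z| ≤ δ →
      |exponentRemainder Φ h y z - ∑ n ∈ Finset.range (M + 1),
        PowerSeries.coeff n (exponentSeries Φ h y 1) * z ^ n| ≤ c * |z| ^ (M + 1) := by
    intro M
    obtain ⟨G, hG, H⟩ :=
      exists_contDiff_iteratedDeriv_line (contDiff_displacement hΦ) (M + 3)
    have hcont : ContinuousOn (fun q : Plane × ℝ => G (q.1 + q.2 • h q.1, h q.1))
        (C ×ˢ Icc (-δ) δ) := by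
      refine hG.continuous.comp_continuousOn ?_
      have : ContinuousOn (fun q : Plane × ℝ => h q.1) (C ×ˢ Icc (-δ) δ) :=
        hh.comp continuousOn_fst fun q hq => hq.1
      exact (continuousOn_fst.add (continuousOn_snd.smul this)).prodMk this
    obtain ⟨c, hc⟩ := (hC.prod isCompact_Icc).exists_bound_of_continuousOn hcont
    refine ⟨|c| / 2, by positivity, fun y hy z hz => ?_⟩
    rcases eq_or_ne z 0 with rfl | hz0
    · have := constantCoeff_exponentSeries Φ h y 1
      rw [Finset.sum_range_succ']
      simp [exponentRemainder, this]
    have hline : ContDiff ℝ ∞ fun z : ℝ => displacement Φ (y + z • h y) :=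
      (contDiff_displacement hΦ).comp (by fun_prop)
    have key := abs_sub_taylor_le (δ := δ) (M + 3) hline (c := |c|) (fun z hz => by
      rw [H]
      exact (hc (y, z) ⟨hy, abs_le.1 hz⟩).trans (le_abs_self c)) z hz
    have hs : ∀ k, iteratedDeriv k (fun z : ℝ => displacement Φ (y + z • h y)) 0 = s Φ h k y :=
      fun k => rfl
    simp only [hs] at key
    have hsum : exponentRemainder Φ h y z - ∑ n ∈ Finset.range (M + 1),
          PowerSeries.coeff n (exponentSeries Φ h y 1) * z ^ n =
        -(displacement Φ (y + z • h y) - ∑ k ∈ Finset.range (M + 3),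
          s Φ h k y / (k.factorial : ℝ) * z ^ k) / (2 * z ^ 2) := by
      rw [Finset.sum_range_succ' _ (M + 2), Finset.sum_range_succ' _ (M + 1),
        Finset.sum_range_succ' _ M, Finset.sum_range_succ' _ M]
      rw [s_zero_eq hΦ (hfix hy), zero_add, s_one_eq hΦ (hfix hy)]
      have h0 := constantCoeff_exponentSeries Φ h y 1
      simp only [coeff_exponentSeries_one, PowerSeries.coeff_zero_eq_constantCoeff, h0,
        exponentRemainder]
      have : ∑ k ∈ Finset.range M, s Φ h (k + 1 + 1 + 1) y / ((k + 1 + 1 + 1).factorial : ℝ)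
            * z ^ (k + 1 + 1 + 1) =
          -(2 * z ^ 2) * ∑ k ∈ Finset.range M,
            -(1 / 2) * (s Φ h (k + 3) y / ((k + 3).factorial : ℝ)) * z ^ (k + 1) := by
        rw [Finset.mul_sum]
        refine Finset.sum_congr rfl fun k _ => ?_
        ring
      rw [this]
      norm_num
      field_simp
      ring
    rw [hsum, abs_div, abs_neg, div_le_iff₀ (by positivity)]
    refine key.trans (le_of_eq ?_)
    rw [abs_mul, abs_two, abs_pow]
    ring
  intro M
  match M with
  | M + 1 => exact hsucc M
  | 0 =>
    obtain ⟨c, hc, H⟩ := hsucc 0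
    refine ⟨c * |δ|, by positivity, fun y hy z hz => ?_⟩
    have h0 := constantCoeff_exponentSeries Φ h y 1
    have := H y hy z hz
    simp only [zero_add, Finset.range_one, Finset.sum_singleton, pow_zero, mul_one, pow_one,
      PowerSeries.coeff_zero_eq_constantCoeff, h0, sub_zero] at this
    simpa using this.trans (mul_le_mul_of_nonneg_left (hz.trans (le_abs_self δ)) hc)

end

/-! ### Laplace's method along the normals -/

theorem IsUnitNormalField.continuousOn {C : Set Plane} {h : Plane → Plane}
    (hh : IsUnitNormalField C h) : ContinuousOn h C := by
  obtain ⟨U, hU, hCU, hs⟩ := hh.smooth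
  exact hs.continuousOn.mono hCU

theorem IsUnitNormalField.contDiffAt {C : Set Plane} {h : Plane → Plane}
    (hh : IsUnitNormalField C h) {y : Plane} (hy : y ∈ C) : ContDiffAt ℝ ∞ h y := by
  obtain ⟨U, hU, hCU, hs⟩ := hh.smooth
  exact hs.contDiffAt (hU.mem_nhds (hCU hy))

theorem IsUnitNormalField.continuousOn_kappa {C : Set Plane} {h : Plane → Plane}
    (hh : IsUnitNormalField C h) : ContinuousOn (kappa h) C := by
  intro y hy
  have h1 := hh.contDiffAt hy
  have h2 : ContinuousAt (fderiv ℝ h) y := (h1.fderiv_right (m := 0) (by norm_num)).continuousAt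
  have h3 : ContinuousAt h y := h1.continuousAt
  have hc : ∀ i : Fin 2, Continuous fun x : Plane => x i := fun i =>
    (EuclideanSpace.proj (𝕜 := ℝ) i).continuous
  have h4 : ContinuousAt (tangent h) y := by
    have : ContinuousAt (fun y => ![h y 1, -(h y 0)]) y := by
      refine continuousAt_pi.2 fun i => ?_
      fin_cases i
      · exact (hc 1).continuousAt.comp h3
      · exact ((hc 0).continuousAt.comp h3).neg
    exact (PiLp.continuous_toLp 2 (fun _ : Fin 2 => ℝ)).continuousAt.comp this
  have h5 := h2.clm_apply h4
  have : ContinuousAt (kappa h) y :=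
    (((hc 0).continuousAt.comp h5).mul ((hc 1).continuousAt.comp h3)).sub
      (((hc 1).continuousAt.comp h5).mul ((hc 0).continuousAt.comp h3))
  exact this.continuousWithinAt

section

variable {Φ h : Plane → Plane} {C : Set Plane}

theorem hasUniformExpansion_amplitude (hΦ : ContDiff ℝ ∞ Φ) (hC : IsCompact C)
    (hfix : C ⊆ Function.fixedPoints Φ) (hh : IsUnitNormalField C h) {δ : ℝ} (hδ : 0 < δ) (j : ℕ) :
    HasUniformExpansion C δ (fun y z => exponentRemainder Φ h y z ^ j * (1 + kappa h y * z))
      (amplitudeSeries Φ h j) := by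
  obtain ⟨c, hc⟩ := hC.exists_bound_of_continuousOn hh.continuousOn_kappa
  exact ((hasUniformExpansion_exponentRemainder hΦ hC hfix hh.continuousOn δ).pow hδ j).mul hδ
    (.one_add_mul _ hc)

/-- A common radius on which the exponent remainder is small against the quadratic part. -/
theorem exists_exponentRemainder_le (hΦ : ContDiff ℝ ∞ Φ) (hC : IsCompact C)
    (hfix : C ⊆ Function.fixedPoints Φ) (hh : IsUnitNormalField C h) {σ : ℝ} (hσ : 0 < σ) :
    ∃ δ₀ > 0, ∀ y ∈ C, ∀ z : ℝ, |z| ≤ δ₀ → |exponentRemainder Φ h y z| ≤ σ := by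
  obtain ⟨c, hc, H⟩ := hasUniformExpansion_exponentRemainder hΦ hC hfix hh.continuousOn 1 1
  refine ⟨min 1 (σ / (c + 1)), by positivity, fun y hy z hz => ?_⟩
  have h1 := H y hy z (hz.trans (min_le_left _ _))
  have h0 := constantCoeff_exponentSeries Φ h y 1
  simp only [Finset.range_one, Finset.sum_singleton, pow_zero, mul_one, pow_one,
    PowerSeries.coeff_zero_eq_constantCoeff, h0, sub_zero] at h1
  refine h1.trans ?_
  have h2 : |z| ≤ σ / (c + 1) := hz.trans (min_le_right _ _)
  rw [le_div_iff₀ (by positivity)] at h2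
  nlinarith [abs_nonneg z]

theorem abs_exp_sub_sum_le (x : ℝ) (n : ℕ) :
    |Real.exp x - ∑ m ∈ Finset.range n, x ^ m / m.factorial| ≤ |x| ^ n * Real.exp |x| := by
  have := Complex.norm_exp_sub_sum_le_norm_mul_exp (x : ℂ) n
  rw [Complex.norm_real, Real.norm_eq_abs] at this
  rw [← Real.norm_eq_abs, ← Complex.norm_real]
  push_cast
  exact this

/-- The rescaled integrand, cut off at `|z| ≤ δ`, is its formal expansion up to order `N` in
`X = t^(1/2)`, uniformly in `y`, with an error that a Gaussian dominates. Here `z = X w`. -/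
theorem exists_pointwise_bound (hΦ : ContDiff ℝ ∞ Φ) (hC : IsCompact C)
    (hfix : C ⊆ Function.fixedPoints Φ) (hh : IsUnitNormalField C h) {σ δ : ℝ} (hσ : 0 ≤ σ)
    (hδ : 0 < δ) (hrem : ∀ y ∈ C, ∀ z : ℝ, |z| ≤ δ → |exponentRemainder Φ h y z| ≤ σ) (N : ℕ) :
    ∃ c : ℝ, 0 ≤ c ∧ ∀ y ∈ C, ∀ X : ℝ, 0 < X → X ≤ 1 → ∀ w : ℝ,
      |(Icc (-δ) δ).indicator (fun z => Real.exp (w ^ 2 * exponentRemainder Φ h y z) *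
          (1 + kappa h y * z)) (X * w) -
        ∑ n ∈ Finset.range N, X ^ n * PowerSeries.coeff n (bSeries Φ h y w)| ≤
      c * X ^ N * ((1 + |w|) ^ (4 * N) * Real.exp (σ * w ^ 2)) := by
  have hexp := fun j => hasUniformExpansion_amplitude hΦ hC hfix hh hδ j
  obtain ⟨cq, hcq, hq⟩ := hasUniformExpansion_exponentRemainder hΦ hC hfix hh.continuousOn δ 1
  obtain ⟨cκ, hcκ, hκ⟩ := (hexp 0).bounded
  choose c hc hcb using fun j => hexp j N
  choose d hd hdb using fun j n => (hexp j).coeff_bounded hδ n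
  set D : ℝ := ∑ n ∈ Finset.range N, ∑ j ∈ Finset.range N, d j n with hD
  have hD0 : 0 ≤ D := Finset.sum_nonneg fun n _ => Finset.sum_nonneg fun j _ => hd j n
  have hS0 : 0 ≤ ∑ j ∈ Finset.range N, c j := Finset.sum_nonneg fun j _ => hc j
  refine ⟨cq ^ N * cκ + ∑ j ∈ Finset.range N, c j + D / δ ^ N, by positivity,
    fun y hy X hX hX1 w => ?_⟩
  have hb : ∀ n ∈ Finset.range N, PowerSeries.coeff n (bSeries Φ h y w) =
      ∑ j ∈ Finset.range N, ((j.factorial : ℝ))⁻¹ *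
        PowerSeries.coeff n (amplitudeSeries Φ h j y) * w ^ (2 * j + n) := fun n hn =>
    coeff_bSeries Φ h y w (Finset.mem_range.1 hn)
  rw [Finset.sum_congr rfl fun n hn => by rw [hb n hn]]
  have hw1 : 1 ≤ 1 + |w| := by linarith [abs_nonneg w]
  have hwle : |w| ≤ 1 + |w| := by linarith
  have hpow : ∀ m, m ≤ 4 * N → |w| ^ m ≤ (1 + |w|) ^ (4 * N) := fun m hm =>
    (pow_le_pow_left₀ (abs_nonneg w) hwle m).trans (pow_le_pow_right₀ hw1 hm)
  have hE1 : 1 ≤ Real.exp (σ * w ^ 2) := Real.one_le_exp (by positivity)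
  have hfact : ∀ j : ℕ, ((j.factorial : ℝ))⁻¹ ≤ 1 := fun j =>
    inv_le_one_of_one_le₀ (by exact_mod_cast j.factorial_pos)
  have hfact0 : ∀ j : ℕ, 0 ≤ ((j.factorial : ℝ))⁻¹ := fun j => by positivity
  by_cases hz : |X * w| ≤ δ
  · rw [indicator_of_mem (show X * w ∈ Icc (-δ) δ from abs_le.1 hz)]
    set q := exponentRemainder Φ h y (X * w) with hqdef
    set m := 1 + kappa h y * (X * w) with hm
    have hm_le : |m| ≤ cκ := by simpa using hκ y hy (X * w) hz
    have hq_le : |q| ≤ cq * (X * |w|) := by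
      have := hq y hy (X * w) hz
      have h0 := constantCoeff_exponentSeries Φ h y 1
      simp only [Finset.range_one, Finset.sum_singleton, pow_zero, mul_one, pow_one,
        PowerSeries.coeff_zero_eq_constantCoeff, h0, sub_zero, abs_mul, abs_of_pos hX] at this
      exact this
    have hq_σ : |q| ≤ σ := hrem y hy _ hz
    -- the exponential is replaced by its Taylor polynomial, then each term by its expansion in `z`
    have hsplit : Real.exp (w ^ 2 * q) * m - ∑ n ∈ Finset.range N, X ^ n *
          ∑ j ∈ Finset.range N, ((j.factorial : ℝ))⁻¹ *
            PowerSeries.coeff n (amplitudeSeries Φ h j y) * w ^ (2 * j + n) =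
        (Real.exp (w ^ 2 * q) - ∑ j ∈ Finset.range N, (w ^ 2 * q) ^ j / (j.factorial : ℝ)) * m +
        ∑ j ∈ Finset.range N, ((j.factorial : ℝ))⁻¹ * w ^ (2 * j) *
          (q ^ j * m - ∑ n ∈ Finset.range N,
            PowerSeries.coeff n (amplitudeSeries Φ h j y) * (X * w) ^ n) := by
      simp only [mul_sub, sub_mul, Finset.sum_sub_distrib, Finset.mul_sum, Finset.sum_mul]
      rw [Finset.sum_comm]
      have e1 : ∀ j n : ℕ, X ^ n * (((j.factorial : ℝ))⁻¹ *
            PowerSeries.coeff n (amplitudeSeries Φ h j y) * w ^ (2 * j + n)) =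
          ((j.factorial : ℝ))⁻¹ * w ^ (2 * j) *
            (PowerSeries.coeff n (amplitudeSeries Φ h j y) * (X * w) ^ n) := by
        intro j n; rw [pow_add, mul_pow]; ring
      have e2 : ∀ j : ℕ, (w ^ 2 * q) ^ j / (j.factorial : ℝ) * m =
          ((j.factorial : ℝ))⁻¹ * w ^ (2 * j) * (q ^ j * m) := by
        intro j; rw [mul_pow, ← pow_mul]; ring
      simp only [e1, e2]
      ring
    have hfst : |(Real.exp (w ^ 2 * q) -
        ∑ j ∈ Finset.range N, (w ^ 2 * q) ^ j / (j.factorial : ℝ)) * m| ≤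
        cq ^ N * cκ * X ^ N * ((1 + |w|) ^ (4 * N) * Real.exp (σ * w ^ 2)) := by
      have habs : |w ^ 2 * q| = |w| ^ 2 * |q| := by rw [abs_mul, abs_pow]
      have h1 : |w ^ 2 * q| ^ N ≤ cq ^ N * X ^ N * |w| ^ (3 * N) := by
        calc |w ^ 2 * q| ^ N ≤ (|w| ^ 2 * (cq * (X * |w|))) ^ N := by
              rw [habs]; gcongr
          _ = cq ^ N * X ^ N * |w| ^ (3 * N) := by
              rw [pow_mul, ← mul_pow, ← mul_pow]; ring
      have h2 : Real.exp |w ^ 2 * q| ≤ Real.exp (σ * w ^ 2) := by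
        rw [habs, sq_abs, mul_comm]
        gcongr
      rw [abs_mul]
      calc _ ≤ (|w ^ 2 * q| ^ N * Real.exp |w ^ 2 * q|) * cκ := by
            gcongr; exact abs_exp_sub_sum_le _ _
        _ ≤ ((cq ^ N * X ^ N * (1 + |w|) ^ (4 * N)) * Real.exp (σ * w ^ 2)) * cκ := by
            gcongr
            exact h1.trans (by gcongr; exact hpow _ (by omega))
        _ = _ := by ring
    have hsnd : |∑ j ∈ Finset.range N, ((j.factorial : ℝ))⁻¹ * w ^ (2 * j) *
          (q ^ j * m - ∑ n ∈ Finset.range N,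
            PowerSeries.coeff n (amplitudeSeries Φ h j y) * (X * w) ^ n)| ≤
        (∑ j ∈ Finset.range N, c j) * X ^ N *
          ((1 + |w|) ^ (4 * N) * Real.exp (σ * w ^ 2)) := by
      refine (Finset.abs_sum_le_sum_abs _ _).trans ?_
      rw [Finset.sum_mul, Finset.sum_mul]
      refine Finset.sum_le_sum fun j hj => ?_
      have hjN := Finset.mem_range.1 hj
      rw [abs_mul, abs_mul, abs_of_nonneg (hfact0 j), abs_pow]
      calc _ ≤ 1 * |w| ^ (2 * j) * (c j * |X * w| ^ N) := by
            gcongr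
            · exact hfact j
            · exact hcb j y hy (X * w) hz
        _ = c j * X ^ N * |w| ^ (2 * j + N) := by
            rw [abs_mul, abs_of_pos hX, pow_add, mul_pow]; ring
        _ ≤ c j * X ^ N * ((1 + |w|) ^ (4 * N) * 1) := by
            have := hc j
            rw [mul_one]
            gcongr
            exact hpow _ (by omega)
        _ ≤ _ := by
            have := hc j
            gcongr
    rw [hsplit]
    refine ((abs_add_le _ _).trans (add_le_add hfst hsnd)).trans ?_
    rw [← add_mul, ← add_mul]
    exact mul_le_mul_of_nonneg_right (mul_le_mul_of_nonneg_right
      (le_add_of_nonneg_right (by positivity)) (by positivity)) (by positivity)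
  · -- beyond the cut-off, `1 ≤ (X |w| / δ) ^ N`
    have hnot : X * w ∉ Icc (-δ) δ := fun hmem => hz (abs_le.2 hmem)
    rw [indicator_of_notMem hnot, zero_sub, abs_neg]
    push Not at hz
    rw [abs_mul, abs_of_pos hX] at hz
    have hone : 1 ≤ X ^ N * |w| ^ N / δ ^ N := by
      rw [one_le_div (by positivity), ← mul_pow]
      exact pow_le_pow_left₀ hδ.le hz.le N
    have hsum : |∑ n ∈ Finset.range N, X ^ n *
          ∑ j ∈ Finset.range N, ((j.factorial : ℝ))⁻¹ *
            PowerSeries.coeff n (amplitudeSeries Φ h j y) * w ^ (2 * j + n)| ≤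
        D * (1 + |w|) ^ (3 * N) := by
      refine (Finset.abs_sum_le_sum_abs _ _).trans ?_
      rw [hD, Finset.sum_mul]
      refine Finset.sum_le_sum fun n hn => ?_
      rw [abs_mul, Finset.sum_mul]
      have hXn : |X ^ n| ≤ 1 := by
        rw [abs_pow, abs_of_pos hX]; exact pow_le_one₀ hX.le hX1
      refine (mul_le_of_le_one_left (abs_nonneg _) hXn).trans
        ((Finset.abs_sum_le_sum_abs _ _).trans (Finset.sum_le_sum fun j hj => ?_))
      have hnN := Finset.mem_range.1 hn
      have hjN := Finset.mem_range.1 hj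
      rw [abs_mul, abs_mul, abs_of_nonneg (hfact0 j), abs_pow]
      calc _ ≤ 1 * d j n * (1 + |w|) ^ (3 * N) := by
            have h1 := hd j n
            gcongr
            · exact hfact j
            · exact hdb j n y hy
            · exact (pow_le_pow_left₀ (abs_nonneg w) hwle _).trans
                (pow_le_pow_right₀ hw1 (by omega))
        _ = _ := by ring
    calc _ ≤ D * (1 + |w|) ^ (3 * N) * 1 := by rw [mul_one]; exact hsum
      _ ≤ D * (1 + |w|) ^ (3 * N) * (X ^ N * |w| ^ N / δ ^ N) := by gcongr
      _ ≤ D * (1 + |w|) ^ (3 * N) * (X ^ N * (1 + |w|) ^ N / δ ^ N) := by gcongr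
      _ = D / δ ^ N * X ^ N * ((1 + |w|) ^ (4 * N) * 1) := by
          rw [show 4 * N = 3 * N + N by ring, pow_add]; ring
      _ ≤ _ := by
          gcongr
          exact le_add_of_nonneg_left (by positivity)

theorem sum_range_two_mul_of_odd_eq_zero {c : ℕ → ℝ} (hc : ∀ n, Odd n → c n = 0) (N : ℕ) :
    ∑ n ∈ Finset.range (2 * N), c n = ∑ k ∈ Finset.range N, c (2 * k) := by
  induction N with
  | zero => simp
  | succ N ih =>
    rw [show 2 * (N + 1) = 2 * N + 1 + 1 by ring, Finset.sum_range_succ, Finset.sum_range_succ, ih,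
      hc (2 * N + 1) ⟨N, rfl⟩, add_zero, Finset.sum_range_succ]

theorem exp_mul_coeff_bSeries_eq_sum (y : Plane) (n : ℕ) :
    (fun w : ℝ => Real.exp (-(s Φ h 2 y / 4 * w ^ 2)) *
      PowerSeries.coeff n (bSeries Φ h y w)) = fun w => ∑ j ∈ Finset.range (n + 1),
      ((j.factorial : ℝ))⁻¹ * PowerSeries.coeff n (amplitudeSeries Φ h j y) *
        (w ^ (2 * j + n) * Real.exp (-(s Φ h 2 y / 4 * w ^ 2))) := by
  ext w
  rw [coeff_bSeries Φ h y w (Nat.lt_succ_self n), Finset.mul_sum]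
  exact Finset.sum_congr rfl fun j _ => by ring

/-- The odd coefficients of `B` are odd polynomials in `z`. -/
theorem integral_exp_mul_coeff_bSeries_of_odd {y : Plane} (hs : 0 < s Φ h 2 y) {n : ℕ}
    (hn : Odd n) : ∫ w : ℝ, Real.exp (-(s Φ h 2 y / 4 * w ^ 2)) *
      PowerSeries.coeff n (bSeries Φ h y w) = 0 := by
  rw [exp_mul_coeff_bSeries_eq_sum, integral_finsetSum]
  · refine Finset.sum_eq_zero fun j _ => ?_
    rw [integral_const_mul, integral_odd_pow_mul_exp _ (by
      rw [Nat.odd_add']; simp [hn]), mul_zero]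
  · intro j _
    exact (integrable_pow_mul_exp_neg_mul_sq (by positivity) _).const_mul _

theorem integrable_exp_mul_coeff_bSeries {y : Plane} (hs : 0 < s Φ h 2 y) (n : ℕ) :
    Integrable fun w : ℝ => Real.exp (-(s Φ h 2 y / 4 * w ^ 2)) *
      PowerSeries.coeff n (bSeries Φ h y w) := by
  rw [exp_mul_coeff_bSeries_eq_sum]
  refine integrable_finsetSum _ fun j _ => ?_
  exact (integrable_pow_mul_exp_neg_mul_sq (by positivity) _).const_mul _

theorem integrable_one_add_abs_pow_mul_exp {c : ℝ} (hc : 0 < c) (n : ℕ) :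
    Integrable fun w : ℝ => (1 + |w|) ^ n * Real.exp (-(c * w ^ 2)) := by
  have h1 : (fun w : ℝ => (1 + |w|) ^ n * Real.exp (-(c * w ^ 2))) = fun w =>
      ∑ m ∈ Finset.range (n + 1), (n.choose m : ℝ) *
        (|w| ^ m * Real.exp (-(c * w ^ 2))) := by
    ext w
    rw [add_comm 1 |w|, add_pow, Finset.sum_mul]
    exact Finset.sum_congr rfl fun m _ => by ring
  rw [h1]
  exact integrable_finsetSum _ fun m _ => (integrable_abs_pow_mul_exp_neg_mul_sq hc m).const_mul _

/-- The integrand of the heat trace along the normal at `y`, including the Jacobian. -/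
noncomputable def normalIntegrand (Φ h : Plane → Plane) (t : ℝ) (y : Plane) (z : ℝ) : ℝ :=
  deformedHeatKernel Φ t (y + z • h y) (y + z • h y) * (1 + z * kappa h y)

theorem deformedHeatKernel_self (Φ : Plane → Plane) (t : ℝ) (x : Plane) :
    deformedHeatKernel Φ t x x = (4 * π * t)⁻¹ * Real.exp (-(displacement Φ x / (2 * t))) := rfl

theorem continuous_deformedHeatKernel (hΦ : ContDiff ℝ ∞ Φ) (t : ℝ) :
    Continuous fun x => deformedHeatKernel Φ t x x := by
  have := (contDiff_displacement hΦ).continuous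
  simp only [deformedHeatKernel_self]
  fun_prop

theorem continuous_normalIntegrand (hΦ : ContDiff ℝ ∞ Φ) (t : ℝ) (y : Plane) :
    Continuous (normalIntegrand Φ h t y) := by
  have h1 := (continuous_deformedHeatKernel hΦ t).comp
    (show Continuous fun z : ℝ => y + z • h y by fun_prop)
  exact h1.mul (by fun_prop)

theorem normalIntegrand_eq {y : Plane} (hy : y ∈ Function.fixedPoints Φ) {X : ℝ} (hX : 0 < X)
    (w : ℝ) :
    normalIntegrand Φ h (X ^ 2) y (X * w) = (4 * π * X ^ 2)⁻¹ *
      (Real.exp (-(s Φ h 2 y / 4 * w ^ 2)) * (Real.exp (w ^ 2 * exponentRemainder Φ h y (X * w)) *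
        (1 + kappa h y * (X * w)))) := by
  rw [normalIntegrand, deformedHeatKernel_self, mul_assoc, ← mul_assoc (Real.exp _) (Real.exp _),
    ← Real.exp_add, mul_comm (kappa h y)]
  congr 3
  rcases eq_or_ne w 0 with rfl | hw
  · simp [displacement_eq, hy.eq]
  · rw [exponentRemainder]
    field_simp
    ring

/-- Laplace's method on a normal segment, uniformly along the curve. -/
theorem exists_normal_expansion (hΦ : ContDiff ℝ ∞ Φ) (hC : IsCompact C)
    (hfix : C ⊆ Function.fixedPoints Φ) (hh : IsUnitNormalField C h) {σ δ : ℝ} (hσ : 0 < σ)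
    (hs : ∀ y ∈ C, σ ≤ s Φ h 2 y) (hδ : 0 < δ)
    (hrem : ∀ y ∈ C, ∀ z : ℝ, |z| ≤ δ → |exponentRemainder Φ h y z| ≤ σ / 8) (N : ℕ) :
    ∃ K : ℝ, ∀ y ∈ C, ∀ t : ℝ, 0 < t → t ≤ 1 →
      |(∫ z in Icc (-δ) δ, normalIntegrand Φ h t y z) -
        ∑ k ∈ Finset.range N, t ^ ((2 * (k : ℝ) - 1) / 2) * a Φ h k y| ≤
      K * t ^ ((2 * (N : ℝ) - 1) / 2) := by
  obtain ⟨c, hc, H⟩ := exists_pointwise_bound hΦ hC hfix hh (by positivity) hδ hrem (2 * N)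
  set I := ∫ w : ℝ, (1 + |w|) ^ (4 * (2 * N)) * Real.exp (-(σ / 8 * w ^ 2)) with hI
  refine ⟨(4 * π)⁻¹ * (c * I), fun y hy t ht ht1 => ?_⟩
  -- after the substitution `z = X w`, the segment becomes all of `ℝ` up to the cut-off
  set X := √t with hXdef
  have hX : 0 < X := Real.sqrt_pos.2 ht
  have hX1 : X ≤ 1 := Real.sqrt_le_one.2 ht1
  have hXt : X ^ 2 = t := Real.sq_sqrt ht.le
  have hsy : 0 < s Φ h 2 y := hσ.trans_le (hs y hy)
  have hpow : ∀ k : ℕ, t ^ ((2 * (k : ℝ) - 1) / 2) = t⁻¹ * X * X ^ (2 * k) := by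
    intro k
    have : (2 * (k : ℝ) - 1) / 2 = -1 + 1 / 2 + k := by ring
    rw [this, Real.rpow_add ht, Real.rpow_add ht, Real.rpow_neg_one, ← Real.sqrt_eq_rpow,
      Real.rpow_natCast, pow_mul, hXt]
  set E : ℝ → ℝ := fun w => Real.exp (-(s Φ h 2 y / 4 * w ^ 2)) with hE
  set g : ℝ → ℝ := (Icc (-δ) δ).indicator (normalIntegrand Φ h t y) with hg
  have hgint : Integrable g := by
    rw [hg, integrable_indicator_iff measurableSet_Icc]
    exact (continuous_normalIntegrand hΦ t y).integrableOn_Icc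
  set G : ℝ → ℝ := fun w => E w * (Icc (-δ) δ).indicator (fun z =>
    Real.exp (w ^ 2 * exponentRemainder Φ h y z) * (1 + kappa h y * z)) (X * w) with hGdef
  have hgG : ∀ w, g (X * w) = (4 * π * t)⁻¹ * G w := by
    intro w
    by_cases hw : X * w ∈ Icc (-δ) δ
    · simp only [hg, hGdef, hE, indicator_of_mem hw]
      have := normalIntegrand_eq (h := h) (hfix hy) hX w
      rw [hXt] at this
      exact this
    · simp [hg, hGdef, indicator_of_notMem hw]
  have hGint : Integrable G := by
    have h1 := (hgint.comp_mul_left' hX.ne').const_mul (4 * π * t)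
    refine h1.congr (ae_of_all _ fun w => ?_)
    simp only [hgG]
    have := pi_pos
    field_simp
  have hmain : |(∫ w, G w) - ∑ n ∈ Finset.range (2 * N), X ^ n *
      ∫ w, E w * PowerSeries.coeff n (bSeries Φ h y w)| ≤ c * X ^ (2 * N) * I := by
    have hBint : ∀ n, Integrable fun w => X ^ n * (E w * PowerSeries.coeff n (bSeries Φ h y w)) :=
      fun n => (integrable_exp_mul_coeff_bSeries hsy n).const_mul _
    have e1 : (∫ w, G w) - ∑ n ∈ Finset.range (2 * N), X ^ n *
        ∫ w, E w * PowerSeries.coeff n (bSeries Φ h y w) =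
        ∫ w, (G w - ∑ n ∈ Finset.range (2 * N),
          X ^ n * (E w * PowerSeries.coeff n (bSeries Φ h y w))) := by
      rw [integral_sub hGint (integrable_finsetSum _ fun n _ => hBint n),
        integral_finsetSum _ fun n _ => hBint n]
      simp only [integral_const_mul]
    rw [e1, hI, ← integral_const_mul, ← Real.norm_eq_abs]
    refine norm_integral_le_of_norm_le
      ((integrable_one_add_abs_pow_mul_exp (by positivity) _).const_mul _) (ae_of_all _ fun w => ?_)
    have e2 : G w - ∑ n ∈ Finset.range (2 * N),
          X ^ n * (E w * PowerSeries.coeff n (bSeries Φ h y w)) =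
        E w * ((Icc (-δ) δ).indicator (fun z =>
          Real.exp (w ^ 2 * exponentRemainder Φ h y z) * (1 + kappa h y * z)) (X * w) -
          ∑ n ∈ Finset.range (2 * N), X ^ n * PowerSeries.coeff n (bSeries Φ h y w)) := by
      rw [mul_sub, Finset.mul_sum]
      congr 1
      exact Finset.sum_congr rfl fun n _ => by ring
    rw [e2, Real.norm_eq_abs, abs_mul, abs_of_pos (Real.exp_pos _)]
    have hEle : E w ≤ Real.exp (-(σ / 4 * w ^ 2)) := by
      simp only [hE]
      have := hs y hy
      gcongr
    calc _ ≤ Real.exp (-(σ / 4 * w ^ 2)) * (c * X ^ (2 * N) *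
          ((1 + |w|) ^ (4 * (2 * N)) * Real.exp (σ / 8 * w ^ 2))) :=
          mul_le_mul hEle (H y hy X hX hX1 w) (abs_nonneg _) (Real.exp_pos _).le
      _ = c * X ^ (2 * N) * ((1 + |w|) ^ (4 * (2 * N)) *
          (Real.exp (-(σ / 4 * w ^ 2)) * Real.exp (σ / 8 * w ^ 2))) := by ring
      _ = _ := by
          rw [← Real.exp_add]
          congr 4
          ring
  have hg2 : ∫ z in Icc (-δ) δ, normalIntegrand Φ h t y z =
      X * ((4 * π * t)⁻¹ * ∫ w, G w) := by
    rw [← integral_indicator measurableSet_Icc]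
    have h1 := Measure.integral_comp_mul_left g X
    simp only [hgG, integral_const_mul] at h1
    rw [h1, abs_of_pos (inv_pos.2 hX), smul_eq_mul, mul_inv_cancel_left₀ hX.ne']
  have hsum : ∑ n ∈ Finset.range (2 * N), X ^ n *
      ∫ w, E w * PowerSeries.coeff n (bSeries Φ h y w) =
      ∑ k ∈ Finset.range N, X ^ (2 * k) * (4 * π * a Φ h k y) := by
    rw [sum_range_two_mul_of_odd_eq_zero (fun n hn => by
      rw [integral_exp_mul_coeff_bSeries_of_odd hsy hn, mul_zero])]
    refine Finset.sum_congr rfl fun k _ => ?_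
    have := pi_pos.ne'
    rw [a, mul_inv_cancel_left₀ (by positivity)]
    rfl
  rw [hsum] at hmain
  have hfin : (∫ z in Icc (-δ) δ, normalIntegrand Φ h t y z) -
        ∑ k ∈ Finset.range N, t ^ ((2 * (k : ℝ) - 1) / 2) * a Φ h k y =
      (4 * π)⁻¹ * (t⁻¹ * X) * ((∫ w, G w) -
        ∑ k ∈ Finset.range N, X ^ (2 * k) * (4 * π * a Φ h k y)) := by
    rw [hg2, mul_sub, Finset.mul_sum]
    congr 1
    · rw [mul_inv]; ring
    · refine Finset.sum_congr rfl fun k _ => ?_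
      rw [hpow]
      have := pi_pos.ne'
      field_simp
  rw [hfin, abs_mul, abs_of_pos (by positivity), hpow]
  calc _ ≤ (4 * π)⁻¹ * (t⁻¹ * X) * (c * X ^ (2 * N) * I) := by gcongr
    _ = _ := by ring

theorem continuousOn_coeff_amplitudeSeries (hΦ : ContDiff ℝ ∞ Φ) (hh : IsUnitNormalField C h)
    (j n : ℕ) : ContinuousOn (fun y => PowerSeries.coeff n (amplitudeSeries Φ h j y)) C := by
  have hmul : ∀ p q : Plane → PowerSeries ℝ,
      (∀ n, ContinuousOn (fun y => PowerSeries.coeff n (p y)) C) →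
      (∀ n, ContinuousOn (fun y => PowerSeries.coeff n (q y)) C) →
      ∀ n, ContinuousOn (fun y => PowerSeries.coeff n (p y * q y)) C := by
    intro p q hp hq n
    simp only [PowerSeries.coeff_mul]
    exact continuousOn_finsetSum _ fun i _ => (hp _).mul (hq _)
  have he : ∀ n, ContinuousOn (fun y => PowerSeries.coeff n (exponentSeries Φ h y 1)) C := by
    intro n
    cases n with
    | zero => simpa [constantCoeff_exponentSeries] using continuousOn_const
    | succ n =>
      simp only [coeff_exponentSeries_one]
      exact continuousOn_const.mul ((continuousOn_s hΦ hh.continuousOn _).div_const _)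
  have hpow : ∀ j n,
      ContinuousOn (fun y => PowerSeries.coeff n (exponentSeries Φ h y 1 ^ j)) C := by
    intro j
    induction j with
    | zero => intro n; simpa only [pow_zero] using continuousOn_const
    | succ j ih => simpa only [pow_succ] using hmul _ _ ih he
  refine hmul _ _ (hpow j) (fun n => ?_) n
  simp only [map_add, PowerSeries.coeff_C_mul]
  exact continuousOn_const.add (hh.continuousOn_kappa.mul continuousOn_const)

theorem continuousOn_a (hΦ : ContDiff ℝ ∞ Φ) (hh : IsUnitNormalField C h)
    (hs : ∀ y ∈ C, 0 < s Φ h 2 y) (k : ℕ) : ContinuousOn (a Φ h k) C := by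
  have hs2 := continuousOn_s hΦ hh.continuousOn 2
  refine ContinuousOn.congr ?_ fun y hy => a_eq_sum (hs y hy) (Nat.lt_succ_self (2 * k))
  refine ContinuousOn.mul ?_ (continuousOn_finsetSum _ fun j _ => ContinuousOn.mul
    (continuousOn_const.mul (continuousOn_coeff_amplitudeSeries hΦ hh j _)) (ContinuousOn.mul
      continuousOn_const ((continuousOn_const.div hs2 fun y hy => (hs y hy).ne').pow _)))
  refine (continuousOn_const.mul hs2).rpow_const fun y hy => Or.inl ?_
  exact (mul_pos (by positivity) (hs y hy)).ne'

end

/-! ### Local parametrizations of the curve and arc length -/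

/-- A local parametrization `γ : J → C ∩ W` of the curve `C` near `p`, of class `C^1`. The parameter
is a linear coordinate, `u = ⟪e, γ u⟫`, which makes injectivity, regularity and continuity of the
inverse immediate. -/
structure CurveChart (C : Set Plane) (p : Plane) where
  J : Set ℝ
  W : Set Plane
  γ : ℝ → Plane
  e : Plane
  isOpen_J : IsOpen J
  bounded_J : Bornology.IsBounded J
  isOpen_W : IsOpen W
  mem_W : p ∈ W
  contDiffAt : ∀ u ∈ J, ContDiffAt ℝ 1 γ u
  inner_eq : ∀ u ∈ J, inner ℝ e (γ u) = u
  image_eq : γ '' J = C ∩ W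

theorem exists_curveChart {C : Set Plane} (hC : IsSmoothCurve C) {p : Plane} (hp : p ∈ C) :
    Nonempty (CurveChart C p) := by
  obtain ⟨U, hU, hpU, F, hF, hF0, hCU⟩ := hC p hp
  set L := fderiv ℝ F p with hL
  have hL0 : L ≠ 0 := hF0 p hpU
  set e₀ : Plane := EuclideanSpace.single 0 1
  set e₁ : Plane := EuclideanSpace.single 1 1
  have hLv : ∀ v : Plane, L v = v 0 * L e₀ + v 1 * L e₁ := by
    intro v
    have : v = v 0 • e₀ + v 1 • e₁ := by
      ext i; fin_cases i <;> simp [e₀, e₁]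
    conv_lhs => rw [this]
    simp
  -- the kernel of the differential is spanned by the rotated gradient `e`
  set e : Plane := !₂[-(L e₁), L e₀] with he
  set A : Plane →L[ℝ] ℝ × ℝ := L.prod (innerSL ℝ e) with hA
  have hAinj : Function.Injective A := by
    rw [injective_iff_map_eq_zero]
    intro v hv
    have h1 : L v = 0 := congrArg Prod.fst hv
    have h2 : inner ℝ e v = 0 := congrArg Prod.snd hv
    rw [hLv] at h1
    simp only [he, PiLp.inner_apply, Fin.sum_univ_two] at h2
    simp at h2
    have hne : L e₀ ^ 2 + L e₁ ^ 2 ≠ 0 := by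
      intro h0
      apply hL0
      ext w
      rw [hLv]
      have a0 : L e₀ = 0 := by nlinarith [sq_nonneg (L e₀), sq_nonneg (L e₁)]
      have a1 : L e₁ = 0 := by nlinarith [sq_nonneg (L e₀), sq_nonneg (L e₁)]
      simp [a0, a1]
    have hv0 : (L e₀ ^ 2 + L e₁ ^ 2) * v 0 = 0 := by
      linear_combination L e₀ * h1 - L e₁ * h2
    have hv1 : (L e₀ ^ 2 + L e₁ ^ 2) * v 1 = 0 := by
      linear_combination L e₁ * h1 + L e₀ * h2
    ext i
    fin_cases i
    · exact (mul_eq_zero.1 hv0).resolve_left hne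
    · exact (mul_eq_zero.1 hv1).resolve_left hne
  have hfin : Module.finrank ℝ Plane = Module.finrank ℝ (ℝ × ℝ) := by simp
  set A' : Plane ≃L[ℝ] ℝ × ℝ :=
    (LinearEquiv.ofInjectiveOfFinrankEq (A : Plane →ₗ[ℝ] ℝ × ℝ) hAinj hfin).toContinuousLinearEquiv
    with hA'
  have hA'A : (A' : Plane →L[ℝ] ℝ × ℝ) = A := by ext v <;> rfl
  set f : Plane → ℝ × ℝ := fun x => (F x, inner ℝ e x) with hf
  have hFp : ContDiffAt ℝ 1 F p := (hF.contDiffAt (hU.mem_nhds hpU)).of_le (by norm_num)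
  have hfc : ContDiffAt ℝ 1 f p := hFp.prodMk (innerSL ℝ e).contDiff.contDiffAt
  have hfd : HasFDerivAt f (A' : Plane →L[ℝ] ℝ × ℝ) p := by
    rw [hA'A]
    exact (hFp.differentiableAt (by norm_num)).hasFDerivAt.prodMk (innerSL ℝ e).hasFDerivAt
  set φ := hfc.toOpenPartialHomeomorph f hfd (by norm_num) with hφ
  have hφf : (φ : Plane → ℝ × ℝ) = f := rfl
  have hps : p ∈ φ.source := hfc.mem_toOpenPartialHomeomorph_source hfd (by norm_num)
  have hpt : f p ∈ φ.target := hfc.image_mem_toOpenPartialHomeomorph_target hfd (by norm_num)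
  have hsymm : ContDiffAt ℝ 1 φ.symm (f p) := hfc.to_localInverse hfd (by norm_num)
  have hinv : φ.symm (f p) = p := φ.left_inv hps
  have hev : ∀ᶠ q in 𝓝 (f p), q ∈ φ.target ∧ ContDiffAt ℝ 1 φ.symm q ∧ φ.symm q ∈ U ∧
      q ∈ Metric.ball (f p) 1 := by
    have h1 : ∀ᶠ q in 𝓝 (f p), q ∈ φ.target := φ.open_target.mem_nhds hpt
    have h2 : ∀ᶠ q in 𝓝 (f p), q ∈ Metric.ball (f p) 1 := Metric.ball_mem_nhds _ one_pos
    have h3 : ∀ᶠ q in 𝓝 (f p), φ.symm q ∈ U :=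
      hsymm.continuousAt.eventually_mem (by rw [hinv]; exact hU.mem_nhds hpU)
    exact h1.and ((hsymm.eventually (by norm_num)).and (h3.and h2))
  obtain ⟨V, hV, hVo, hpV⟩ := eventually_nhds_iff.1 hev
  have hFp0 : F p = 0 := by
    have : p ∈ C ∩ U := ⟨hp, hpU⟩
    rw [hCU] at this
    exact this.2
  refine ⟨⟨{u | ((0 : ℝ), u) ∈ V}, φ.source ∩ φ ⁻¹' V, fun u => φ.symm (0, u), e,
    hVo.preimage (by fun_prop), ?_, φ.isOpen_inter_preimage hVo, ⟨hps, hpV⟩, ?_, ?_, ?_⟩⟩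
  · refine (Metric.isBounded_ball (x := inner ℝ e p) (r := 1)).subset fun u hu => ?_
    have h1 := (hV _ hu).2.2.2
    rw [Metric.mem_ball, Prod.dist_eq, max_lt_iff] at h1
    exact h1.2
  · intro u hu
    exact (hV _ hu).2.1.comp u (contDiffAt_const.prodMk contDiffAt_id)
  · intro u hu
    exact congrArg Prod.snd (φ.right_inv (hV _ hu).1)
  · apply Subset.antisymm
    · rintro _ ⟨u, hu, rfl⟩
      have hr := φ.right_inv (hV _ hu).1
      have hF0 : F (φ.symm (0, u)) = 0 := congrArg Prod.fst hr
      have hmem : φ.symm (0, u) ∈ {x ∈ U | F x = 0} := ⟨(hV _ hu).2.2.1, hF0⟩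
      rw [← hCU] at hmem
      refine ⟨hmem.1, φ.map_target (hV _ hu).1, ?_⟩
      rw [mem_preimage, hr]
      exact hu
    · rintro x ⟨hxC, hxs, hxV⟩
      have hl := φ.left_inv hxs
      have hxU : x ∈ U := by
        have := (hV _ hxV).2.2.1
        rwa [hl] at this
      have hx0 : F x = 0 := by
        have : x ∈ C ∩ U := ⟨hxC, hxU⟩
        rw [hCU] at this
        exact this.2
      have hφx : φ x = (0, inner ℝ e x) := by
        rw [hφf, hf]; simp [hx0]
      refine ⟨inner ℝ e x, ?_, ?_⟩
      · rw [mem_preimage, hφx] at hxV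
        exact hxV
      · simp only
        rw [← hφx, hl]

namespace CurveChart

variable {C : Set Plane} {p : Plane} (χ : CurveChart C p)

/-- The coordinate of the chart, inverse to the parametrization. -/
noncomputable def ρ (x : Plane) : ℝ := inner ℝ χ.e x

theorem continuous_ρ : Continuous χ.ρ := (innerSL ℝ χ.e).continuous

theorem ρ_γ {u : ℝ} (hu : u ∈ χ.J) : χ.ρ (χ.γ u) = u := χ.inner_eq u hu

theorem ρ_mem {x : Plane} (hx : x ∈ C ∩ χ.W) : χ.ρ x ∈ χ.J := by
  rw [← χ.image_eq] at hx
  obtain ⟨u, hu, rfl⟩ := hx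
  rwa [χ.ρ_γ hu]

theorem γ_ρ {x : Plane} (hx : x ∈ C ∩ χ.W) : χ.γ (χ.ρ x) = x := by
  rw [← χ.image_eq] at hx
  obtain ⟨u, hu, rfl⟩ := hx
  rw [χ.ρ_γ hu]

theorem γ_mem {u : ℝ} (hu : u ∈ χ.J) : χ.γ u ∈ C ∩ χ.W := χ.image_eq ▸ mem_image_of_mem _ hu

theorem continuousOn_γ : ContinuousOn χ.γ χ.J := fun u hu =>
  (χ.contDiffAt u hu).continuousAt.continuousWithinAt

theorem hasDerivAt {u : ℝ} (hu : u ∈ χ.J) : HasDerivAt χ.γ (deriv χ.γ u) u :=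
  ((χ.contDiffAt u hu).differentiableAt (by norm_num)).hasDerivAt

theorem inner_deriv {u : ℝ} (hu : u ∈ χ.J) : inner ℝ χ.e (deriv χ.γ u) = 1 := by
  have h1 : HasDerivAt (fun v => inner ℝ χ.e (χ.γ v)) (inner ℝ χ.e (deriv χ.γ u)) u :=
    (innerSL ℝ χ.e).hasFDerivAt.comp_hasDerivAt u (χ.hasDerivAt hu)
  have h2 : (fun v => inner ℝ χ.e (χ.γ v)) =ᶠ[𝓝 u] id := by
    filter_upwards [χ.isOpen_J.mem_nhds hu] with v hv using χ.inner_eq v hv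
  exact h1.unique ((hasDerivAt_id u).congr_of_eventuallyEq h2)

theorem deriv_ne_zero {u : ℝ} (hu : u ∈ χ.J) : deriv χ.γ u ≠ 0 := fun h0 => by
  have := χ.inner_deriv hu
  rw [h0, inner_zero_right] at this
  exact zero_ne_one this

theorem continuousOn_deriv : ContinuousOn (deriv χ.γ) χ.J := fun u hu => by
  have h1 : ContinuousAt (fderiv ℝ χ.γ) u :=
    ((χ.contDiffAt u hu).fderiv_right (m := 0) (by norm_num)).continuousAt
  exact (h1.clm_apply continuousAt_const).continuousWithinAt

theorem deriv_mem_tangentConeAt {u : ℝ} (hu : u ∈ χ.J) :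
    deriv χ.γ u ∈ tangentConeAt ℝ C (χ.γ u) := by
  have h1 := (χ.hasDerivAt hu).hasFDerivAt.hasFDerivWithinAt (s := χ.J)
  have h2 := h1.mapsTo_tangent_cone
  rw [tangentConeAt_of_mem_nhds (χ.isOpen_J.mem_nhds hu), χ.image_eq] at h2
  have h3 := h2 (mem_univ (1 : ℝ))
  simp only [ContinuousLinearMap.toSpanSingleton_apply, one_smul] at h3
  exact tangentConeAt_mono inter_subset_left h3

end CurveChart

/-- If one measure is locally dominated by another on an open set, it is dominated there. -/
theorem measure_le_of_locally_le {μ ν : Measure ℝ} {J : Set ℝ}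
    (hloc : ∀ u ∈ J, ∃ V ∈ 𝓝 u, ∀ s ⊆ V ∩ J, MeasurableSet s → μ s ≤ ν s) {s : Set ℝ}
    (hsJ : s ⊆ J) (hs : MeasurableSet s) : μ s ≤ ν s := by
  choose! V hV H using hloc
  obtain ⟨t, htJ, htc, hJt⟩ := TopologicalSpace.countable_cover_nhdsWithin (s := J)
    (f := fun u => interior (V u)) fun u hu =>
      mem_nhdsWithin_of_mem_nhds (interior_mem_nhds.2 (hV u hu))
  rcases t.eq_empty_or_nonempty with rfl | hne
  · have : s = ∅ := by
      rw [eq_empty_iff_forall_notMem]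
      intro x hx
      simpa using hJt (hsJ hx)
    simp [this]
  obtain ⟨g, rfl⟩ := htc.exists_eq_range hne
  set D := disjointed fun n => interior (V (g n)) with hD
  have hDm : ∀ n, MeasurableSet (D n) := fun n =>
    MeasurableSet.disjointed (fun n => isOpen_interior.measurableSet) n
  have hsU : s = ⋃ n, s ∩ D n := by
    rw [← inter_iUnion, hD, iUnion_disjointed, eq_comm, inter_eq_left]
    intro x hx
    simpa using hJt (hsJ hx)
  have hdisj : Pairwise (Function.onFun Disjoint fun n => s ∩ D n) := fun i j hij =>
    ((disjoint_disjointed _) hij).mono inter_subset_right inter_subset_right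
  rw [hsU, measure_iUnion hdisj fun n => hs.inter (hDm n),
    measure_iUnion hdisj fun n => hs.inter (hDm n)]
  refine ENNReal.tsum_le_tsum fun n => H (g n) (htJ ⟨n, rfl⟩) _ (fun x hx => ⟨?_, hsJ hx.1⟩)
    (hs.inter (hDm n))
  exact interior_subset (disjointed_subset (fun n => interior (V (g n))) n hx.2)

namespace CurveChart

variable {C : Set Plane} {p : Plane} (χ : CurveChart C p)

/-- Arc length on `C ∩ W`, transported to the parameter. -/
noncomputable def arcMeasure : Measure ℝ :=
  ((Measure.hausdorffMeasure 1).restrict (C ∩ χ.W)).map χ.ρ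

theorem arcMeasure_apply {s : Set ℝ} (hs : MeasurableSet s)
    (hsJ : s ⊆ χ.J) : χ.arcMeasure s = Measure.hausdorffMeasure 1 (χ.γ '' s) := by
  rw [arcMeasure, Measure.map_apply χ.continuous_ρ.measurable hs,
    Measure.restrict_apply (χ.continuous_ρ.measurable hs)]
  congr 1
  ext x
  constructor
  · rintro ⟨h1, h2⟩
    exact ⟨χ.ρ x, h1, χ.γ_ρ h2⟩
  · rintro ⟨u, hu, rfl⟩
    refine ⟨?_, χ.γ_mem (hsJ hu)⟩
    rw [mem_preimage, χ.ρ_γ (hsJ hu)]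
    exact hu

/-- Near a parameter `u`, the curve is almost a straight line run through at constant speed, so
that `γ` and its inverse `ρ` are Lipschitz with almost inverse constants. -/
theorem exists_nhds_arcMeasure_le {u : ℝ} (hu : u ∈ χ.J) {ε : ℝ}
    (hε : 0 < ε) : ∃ V ∈ 𝓝 u, ∀ s ⊆ V ∩ χ.J, MeasurableSet s →
      χ.arcMeasure s ≤ (∫⁻ v in s, ENNReal.ofReal ‖deriv χ.γ v‖) + ENNReal.ofReal ε * volume s ∧
      (∫⁻ v in s, ENNReal.ofReal ‖deriv χ.γ v‖) ≤ χ.arcMeasure s + ENNReal.ofReal ε * volume s := by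
  set v := ‖deriv χ.γ u‖ with hv
  have hv0 : 0 < v := norm_pos_iff.2 (χ.deriv_ne_zero hu)
  set η := min (ε / 2) (v / 2) with hη
  have hη0 : 0 < η := by positivity
  have hηε : 2 * η ≤ ε := by linarith [min_le_left (ε / 2) (v / 2)]
  have hηv : 0 < v - η := by linarith [min_le_right (ε / 2) (v / 2)]
  have hstrict : HasStrictDerivAt χ.γ (deriv χ.γ u) u :=
    (χ.contDiffAt u hu).hasStrictDerivAt' (χ.hasDerivAt hu) (by norm_num)
  have h1 : ∀ᶠ q : ℝ × ℝ in 𝓝 (u, u),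
      ‖χ.γ q.1 - χ.γ q.2 - (q.1 - q.2) • deriv χ.γ u‖ ≤ η * ‖q.1 - q.2‖ := by
    have := hstrict.isLittleO.def hη0
    simpa using this
  obtain ⟨V₁, hV₁, H₁⟩ := (eventually_prod_self_iff (r := fun x y =>
    ‖χ.γ x - χ.γ y - (x - y) • deriv χ.γ u‖ ≤ η * ‖x - y‖)).1 (by rwa [nhds_prod_eq] at h1)
  have h2 : ∀ᶠ x in 𝓝 u, |‖deriv χ.γ x‖ - v| < η := by
    have hc : ContinuousAt (fun x => ‖deriv χ.γ x‖) u :=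
      ((χ.continuousOn_deriv u hu).continuousAt (χ.isOpen_J.mem_nhds hu)).norm
    have := Metric.continuousAt_iff'.1 hc η hη0
    simpa [Real.dist_eq] using this
  refine ⟨V₁ ∩ {x | |‖deriv χ.γ x‖ - v| < η}, inter_mem hV₁ h2, fun s hs hsm => ?_⟩
  have hsJ : s ⊆ χ.J := fun x hx => (hs hx).2
  have hup : ∀ x ∈ s, ∀ y ∈ s, ‖χ.γ x - χ.γ y‖ ≤ (v + η) * ‖x - y‖ := by
    intro x hx y hy
    have h3 := H₁ x (hs hx).1.1 y (hs hy).1.1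
    have h4 := norm_sub_norm_le (χ.γ x - χ.γ y) ((x - y) • deriv χ.γ u)
    rw [norm_smul] at h4
    nlinarith
  have hlow : ∀ x ∈ s, ∀ y ∈ s, (v - η) * ‖x - y‖ ≤ ‖χ.γ x - χ.γ y‖ := by
    intro x hx y hy
    have h3 := H₁ x (hs hx).1.1 y (hs hy).1.1
    have h4 := norm_sub_norm_le ((x - y) • deriv χ.γ u) (χ.γ x - χ.γ y)
    rw [norm_smul, norm_sub_rev ((x - y) • _)] at h4
    nlinarith
  -- upper bound from `γ`, lower bound from its inverse `ρ`
  have hL1 : LipschitzOnWith (Real.toNNReal (v + η)) χ.γ s := by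
    refine LipschitzOnWith.of_dist_le_mul fun x hx y hy => ?_
    rw [Real.coe_toNNReal _ (by positivity), dist_eq_norm, dist_eq_norm]
    exact hup x hx y hy
  have hL2 : LipschitzOnWith (Real.toNNReal (v - η)⁻¹) χ.ρ (χ.γ '' s) := by
    refine LipschitzOnWith.of_dist_le_mul ?_
    rintro _ ⟨x, hx, rfl⟩ _ ⟨y, hy, rfl⟩
    rw [Real.coe_toNNReal _ (by positivity), dist_eq_norm, dist_eq_norm, χ.ρ_γ (hsJ hx),
      χ.ρ_γ (hsJ hy), inv_mul_eq_div, le_div_iff₀ hηv, mul_comm]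
    exact hlow x hx y hy
  have hm1 : χ.arcMeasure s ≤ ENNReal.ofReal (v + η) * volume s := by
    rw [χ.arcMeasure_apply hsm hsJ, ← hausdorffMeasure_real]
    have := hL1.hausdorffMeasure_image_le zero_le_one
    simpa [ENNReal.ofReal] using this
  have hm2 : ENNReal.ofReal (v - η) * volume s ≤ χ.arcMeasure s := by
    have h5 := hL2.hausdorffMeasure_image_le (d := 1) zero_le_one
    have h6 : χ.ρ '' (χ.γ '' s) = s := by
      rw [image_image]
      conv_rhs => rw [← image_id s]
      exact image_congr fun x hx => χ.ρ_γ (hsJ hx)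
    rw [h6, hausdorffMeasure_real, ← χ.arcMeasure_apply hsm hsJ, ENNReal.rpow_one] at h5
    calc ENNReal.ofReal (v - η) * volume s
        ≤ ENNReal.ofReal (v - η) * (ENNReal.ofReal (v - η)⁻¹ * χ.arcMeasure s) := by
          gcongr; exact h5
      _ = χ.arcMeasure s := by
          rw [← mul_assoc, ← ENNReal.ofReal_mul hηv.le, mul_inv_cancel₀ hηv.ne']
          simp
  have hi1 : (∫⁻ x in s, ENNReal.ofReal ‖deriv χ.γ x‖) ≤ ENNReal.ofReal (v + η) * volume s := by
    rw [← setLIntegral_const]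
    refine setLIntegral_mono' hsm fun x hx => ENNReal.ofReal_le_ofReal ?_
    have : |‖deriv χ.γ x‖ - v| < η := (hs hx).1.2
    have := abs_lt.1 this
    linarith [this.2]
  have hi2 : ENNReal.ofReal (v - η) * volume s ≤ ∫⁻ x in s, ENNReal.ofReal ‖deriv χ.γ x‖ := by
    rw [← setLIntegral_const]
    refine setLIntegral_mono' hsm fun x hx => ENNReal.ofReal_le_ofReal ?_
    have : |‖deriv χ.γ x‖ - v| < η := (hs hx).1.2
    have := abs_lt.1 this
    linarith [this.1]
  have hsplit : ENNReal.ofReal (v + η) * volume s ≤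
      ENNReal.ofReal (v - η) * volume s + ENNReal.ofReal ε * volume s := by
    rw [← add_mul, ← ENNReal.ofReal_add hηv.le hε.le]
    exact mul_le_mul' (ENNReal.ofReal_le_ofReal (by linarith)) le_rfl
  exact ⟨hm1.trans (hsplit.trans (by gcongr)), hi1.trans (hsplit.trans (by gcongr))⟩

/-- The length of a regular curve, measured by the one-dimensional Hausdorff measure, is the
integral of its speed. -/
theorem arcMeasure_eq :
    χ.arcMeasure = (volume.restrict χ.J).withDensity fun u => ENNReal.ofReal ‖deriv χ.γ u‖ := by
  set m : Measure ℝ := volume.withDensity fun u => ENNReal.ofReal ‖deriv χ.γ u‖ with hm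
  have hmeas : Measurable (deriv χ.γ) := measurable_deriv χ.γ
  have hsub : ∀ s ⊆ χ.J, MeasurableSet s → χ.arcMeasure s = m s := by
    intro s hsJ hs
    have hfin : volume s ≠ ⊤ := (χ.bounded_J.subset hsJ).measure_lt_top.ne
    have hmeq : ∀ s, MeasurableSet s → m s = ∫⁻ v in s, ENNReal.ofReal ‖deriv χ.γ v‖ := fun s hs =>
      withDensity_apply _ hs
    have key : ∀ ε : ℝ, 0 < ε →
        χ.arcMeasure s ≤ m s + ENNReal.ofReal ε * volume s ∧
        m s ≤ χ.arcMeasure s + ENNReal.ofReal ε * volume s := by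
      intro ε hε
      constructor
      · refine measure_le_of_locally_le (μ := χ.arcMeasure)
          (ν := m + ENNReal.ofReal ε • volume) (fun u hu => ?_) hsJ hs
        obtain ⟨V, hV, H⟩ := χ.exists_nhds_arcMeasure_le hu hε
        exact ⟨V, hV, fun s hs hsm => by simpa [hmeq s hsm] using (H s hs hsm).1⟩
      · refine measure_le_of_locally_le (μ := m)
          (ν := χ.arcMeasure + ENNReal.ofReal ε • volume) (fun u hu => ?_) hsJ hs
        obtain ⟨V, hV, H⟩ := χ.exists_nhds_arcMeasure_le hu hε
        exact ⟨V, hV, fun s hs hsm => by simpa [hmeq s hsm] using (H s hs hsm).2⟩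
    have hlim : ∀ a : ENNReal, Tendsto (fun ε : ℝ => a + ENNReal.ofReal ε * volume s) (𝓝[>] 0)
        (𝓝 a) := by
      intro a
      have h1 : Tendsto (fun ε : ℝ => ENNReal.ofReal ε) (𝓝[>] 0) (𝓝 0) := by
        have := ENNReal.continuous_ofReal.tendsto 0
        rw [ENNReal.ofReal_zero] at this
        exact this.mono_left nhdsWithin_le_nhds
      have h2 := ENNReal.Tendsto.mul_const h1 (Or.inr hfin)
      rw [zero_mul] at h2
      simpa using tendsto_const_nhds.add h2
    refine le_antisymm (ge_of_tendsto (hlim _) ?_) (ge_of_tendsto (hlim _) ?_)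
    · filter_upwards [self_mem_nhdsWithin] with ε hε using (key ε hε).1
    · filter_upwards [self_mem_nhdsWithin] with ε hε using (key ε hε).2
  ext s hs
  have h1 : χ.arcMeasure s = χ.arcMeasure (s ∩ χ.J) := by
    rw [arcMeasure, Measure.map_apply χ.continuous_ρ.measurable hs,
      Measure.map_apply χ.continuous_ρ.measurable (hs.inter χ.isOpen_J.measurableSet),
      Measure.restrict_apply (χ.continuous_ρ.measurable hs),
      Measure.restrict_apply (χ.continuous_ρ.measurable (hs.inter χ.isOpen_J.measurableSet))]
    congr 1
    ext x
    exact ⟨fun hx => ⟨⟨hx.1, χ.ρ_mem hx.2⟩, hx.2⟩, fun hx => ⟨hx.1.1, hx.2⟩⟩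
  rw [h1, hsub _ inter_subset_right (hs.inter χ.isOpen_J.measurableSet), hm,
    withDensity_apply _ (hs.inter χ.isOpen_J.measurableSet), withDensity_apply _ hs,
    Measure.restrict_restrict hs]

end CurveChart

/-! ### The normal tube -/

/-- Normal coordinates: `(y, z) ↦ y + z h(y)`. -/
def tubeMap (h : Plane → Plane) (q : Plane × ℝ) : Plane := q.1 + q.2 • h q.1

theorem plane_det (A : Plane →L[ℝ] Plane) :
    A.det = A (EuclideanSpace.single 0 1) 0 * A (EuclideanSpace.single 1 1) 1 -
      A (EuclideanSpace.single 1 1) 0 * A (EuclideanSpace.single 0 1) 1 := by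
  have h1 : A.det = LinearMap.det (A : Plane →ₗ[ℝ] Plane) := rfl
  rw [h1, ← LinearMap.det_toMatrix (EuclideanSpace.basisFun (Fin 2) ℝ).toBasis, Matrix.det_fin_two]
  simp [LinearMap.toMatrix_apply]

/-- A vector orthogonal to the unit vector `n` is a multiple of `n` turned by a right angle. -/
theorem exists_eq_smul_tangent {h : Plane → Plane} {y v : Plane} (hn : ‖h y‖ = 1)
    (hv : inner ℝ (h y) v = 0) : ∃ c : ℝ, v = c • tangent h y ∧ |c| = ‖v‖ := by
  have h1 : h y 0 ^ 2 + h y 1 ^ 2 = 1 := by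
    have := EuclideanSpace.real_norm_sq_eq (h y)
    rw [hn, Fin.sum_univ_two] at this
    linarith
  have h2 : h y 0 * v 0 + h y 1 * v 1 = 0 := by
    simp only [PiLp.inner_apply, Fin.sum_univ_two] at hv
    simp at hv
    linarith
  have hvc : v = (v 0 * h y 1 - v 1 * h y 0) • tangent h y := by
    ext i
    fin_cases i
    · simp [tangent]
      linear_combination (-(v 0)) * h1 + h y 0 * h2
    · simp [tangent]
      linear_combination (-(v 1)) * h1 + h y 1 * h2
  refine ⟨_, hvc, ?_⟩
  have ht : ‖tangent h y‖ = 1 := by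
    rw [EuclideanSpace.norm_eq, Fin.sum_univ_two]
    simp [tangent, add_comm, h1]
  conv_rhs => rw [hvc]
  rw [norm_smul, ht, mul_one, Real.norm_eq_abs]

namespace CurveChart

variable {C : Set Plane} {p : Plane} (χ : CurveChart C p) {h : Plane → Plane}

/-- Normal coordinates over a chart, the parameter and the normal coordinate being taken as the two
coordinates of a point of the plane. -/
noncomputable def tube (h : Plane → Plane) (x : Plane) : Plane :=
  χ.γ (x 0) + x 1 • h (χ.γ (x 0))

theorem tube_contDiffAt (hh : IsUnitNormalField C h) {x : Plane} (hx : x 0 ∈ χ.J) :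
    ContDiffAt ℝ 1 (χ.tube h) x := by
  have hc : ∀ i : Fin 2, ContDiff ℝ 1 fun x : Plane => x i := fun i =>
    (EuclideanSpace.proj (𝕜 := ℝ) i).contDiff
  have h1 : ContDiffAt ℝ 1 (fun x : Plane => χ.γ (x 0)) x :=
    (χ.contDiffAt _ hx).comp x (hc 0).contDiffAt
  have h2 : ContDiffAt ℝ 1 (fun x : Plane => h (χ.γ (x 0))) x :=
    ((hh.contDiffAt (χ.γ_mem hx).1).of_le (by norm_num)).comp x h1
  exact h1.add ((hc 1).contDiffAt.smul h2)

/-- The Jacobian of normal coordinates is the speed of the parametrization times `1 + z κ`. -/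
theorem exists_tube_hasFDerivAt (hh : IsUnitNormalField C h) {x : Plane} (hx : x 0 ∈ χ.J) :
    ∃ A : Plane →L[ℝ] Plane, HasFDerivAt (χ.tube h) A x ∧
      |A.det| = ‖deriv χ.γ (x 0)‖ * |1 + x 1 * kappa h (χ.γ (x 0))| := by
  set y := χ.γ (x 0) with hy
  have hyC : y ∈ C := (χ.γ_mem hx).1
  set v := deriv χ.γ (x 0) with hv
  set P : Fin 2 → (Plane →L[ℝ] ℝ) := fun i => EuclideanSpace.proj i with hP
  have hγ : HasFDerivAt (fun x : Plane => χ.γ (x 0)) ((P 0).smulRight v) x := by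
    have := (χ.hasDerivAt hx).hasFDerivAt.comp x (P 0).hasFDerivAt
    refine this.congr_fderiv ?_
    ext w i
    simp [hP, hv]
  have hhd : HasFDerivAt h (fderiv ℝ h y) y :=
    ((hh.contDiffAt hyC).differentiableAt (by norm_num)).hasFDerivAt
  have hhγ := hhd.comp x hγ
  have hA := hγ.add ((P 1).hasFDerivAt.smul hhγ)
  refine ⟨_, hA, ?_⟩
  obtain ⟨c, hc, hcn⟩ := exists_eq_smul_tangent (hh.unit y hyC)
    (hh.normal y hyC v (χ.deriv_mem_tangentConeAt hx))
  have hn : h y 0 ^ 2 + h y 1 ^ 2 = 1 := by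
    have := EuclideanSpace.real_norm_sq_eq (h y)
    rw [hh.unit y hyC, Fin.sum_univ_two] at this
    linarith
  rw [← hcn, ← abs_mul, plane_det]
  congr 1
  have hγx : χ.γ (x.ofLp 0) = y := rfl
  simp only [hP, add_apply, ContinuousLinearMap.smulRight_apply,
    smul_apply, ContinuousLinearMap.comp_apply, PiLp.proj_apply,
    Function.comp_apply, hγx]
  rw [hc]
  simp [kappa, tangent]
  linear_combination c * hn

/-- By the inverse function theorem, normal coordinates over a chart are a local homeomorphism at
the points of the curve. -/
theorem tube_injOn_nhds (hh : IsUnitNormalField C h) {u : ℝ} (hu : u ∈ χ.J) :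
    (∃ N ∈ 𝓝 (!₂[u, 0] : Plane), InjOn (χ.tube h) N) ∧
      Filter.map (χ.tube h) (𝓝 (!₂[u, 0] : Plane)) = 𝓝 (χ.γ u) := by
  have hx : (!₂[u, 0] : Plane) 0 ∈ χ.J := by simpa using hu
  obtain ⟨A, hA, hdet⟩ := χ.exists_tube_hasFDerivAt hh hx
  have hdet0 : A.det ≠ 0 := by
    rw [← abs_ne_zero, hdet]
    simpa using χ.deriv_ne_zero hu
  set A' := A.toContinuousLinearEquivOfDetNeZero hdet0 with hA'
  have hAA' : (A' : Plane →L[ℝ] Plane) = A := by ext v; rfl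
  have hs : HasStrictFDerivAt (χ.tube h) (A' : Plane →L[ℝ] Plane) !₂[u, 0] := by
    rw [hAA']
    exact (χ.tube_contDiffAt hh hx).hasStrictFDerivAt' hA (by norm_num)
  refine ⟨⟨_, (hs.toOpenPartialHomeomorph _).open_source.mem_nhds
    hs.mem_toOpenPartialHomeomorph_source, (hs.toOpenPartialHomeomorph _).injOn⟩, ?_⟩
  rw [hs.map_nhds_eq_of_equiv]
  simp [tube]

theorem tubeMap_eq {q : Plane × ℝ} (hq : q.1 ∈ C ∩ χ.W) :
    tubeMap h q = χ.tube h !₂[χ.ρ q.1, q.2] := by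
  simp [tubeMap, tube, χ.γ_ρ hq]

end CurveChart

section Tube

variable {C : Set Plane} {h : Plane → Plane}

/-- Normal coordinates are injective close to the curve. -/
theorem exists_injOn_tubeMap (hC : IsSmoothCurve C) (hcomp : IsCompact C)
    (hh : IsUnitNormalField C h) :
    ∃ δ > 0, InjOn (tubeMap h) (C ×ˢ Icc (-δ) δ) := by
  have : CompactSpace C := isCompact_iff_compactSpace.1 hcomp
  set f : C × ℝ → Plane := fun q => tubeMap h (q.1, q.2) with hf
  have hcont : Continuous f := by
    have : Continuous fun y : C => h y := hh.continuousOn.domRestrict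
    exact (continuous_subtype_val.comp continuous_fst).add
      (continuous_snd.smul (this.comp continuous_fst))
  have hinj : InjOn f (univ ×ˢ {0}) := by
    rintro ⟨y, z⟩ ⟨-, hz⟩ ⟨y', z'⟩ ⟨-, hz'⟩ heq
    simp only [mem_singleton_iff] at hz hz'
    subst hz hz'
    simpa [hf, tubeMap, Subtype.ext_iff] using heq
  obtain ⟨t, ht, hti⟩ := hinj.exists_mem_nhdsSet (isCompact_univ.prod isCompact_singleton)
    (fun x _ => hcont.continuousAt) (by
      rintro ⟨p, z⟩ ⟨-, hz⟩
      simp only [mem_singleton_iff] at hz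
      subst hz
      obtain ⟨χ⟩ := exists_curveChart hC p.2
      obtain ⟨⟨N, hN, hNi⟩, -⟩ := χ.tube_injOn_nhds hh (χ.ρ_mem ⟨p.2, χ.mem_W⟩)
      set R : C × ℝ → Plane := fun q => !₂[χ.ρ q.1, q.2] with hR
      have hRc : Continuous R := by
        have := χ.continuous_ρ
        refine (PiLp.continuous_toLp 2 (fun _ : Fin 2 => ℝ)).comp (continuous_pi fun i => ?_)
        fin_cases i
        · exact this.comp (continuous_subtype_val.comp continuous_fst)
        · exact continuous_snd
      refine ⟨R ⁻¹' N ∩ {q | (q.1 : Plane) ∈ χ.W}, inter_mem (hRc.continuousAt hN)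
        ((χ.isOpen_W.preimage (by fun_prop)).mem_nhds χ.mem_W), ?_⟩
      rintro ⟨y, z⟩ ⟨hy1, hy2⟩ ⟨y', z'⟩ ⟨hy1', hy2'⟩ heq
      have e1 : f (y, z) = χ.tube h (R (y, z)) := χ.tubeMap_eq (q := (y, z)) ⟨y.2, hy2⟩
      have e2 : f (y', z') = χ.tube h (R (y', z')) := χ.tubeMap_eq (q := (y', z')) ⟨y'.2, hy2'⟩
      rw [e1, e2] at heq
      have hRR := hNi hy1 hy1' heq
      have h0 : χ.ρ y = χ.ρ y' := by simpa [hR] using congrArg (fun x : Plane => x 0) hRR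
      have h1 : z = z' := by simpa [hR] using congrArg (fun x : Plane => x 1) hRR
      have h2 : (y : Plane) = y' := by
        rw [← χ.γ_ρ ⟨y.2, hy2⟩, ← χ.γ_ρ ⟨y'.2, hy2'⟩, h0]
      rw [Subtype.ext h2, h1])
  rw [isCompact_univ.nhdsSet_prod_eq isCompact_singleton, nhdsSet_univ, nhdsSet_singleton] at ht
  obtain ⟨t₁, ht₁, t₂, ht₂, hsub⟩ := Filter.mem_prod_iff.1 ht
  obtain ⟨ε, hε, hball⟩ := Metric.nhds_basis_closedBall.mem_iff.1 ht₂
  refine ⟨ε, hε, ?_⟩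
  rintro ⟨y, z⟩ ⟨hy, hz⟩ ⟨y', z'⟩ ⟨hy', hz'⟩ heq
  have hmem : ∀ (y : C) (z : ℝ), z ∈ Icc (-ε) ε → (y, z) ∈ t := fun y z hz => by
    refine hsub ⟨?_, hball ?_⟩
    · rw [Filter.mem_top.1 ht₁]; trivial
    · rw [mem_closedBall_zero_iff, Real.norm_eq_abs]; exact abs_le.2 hz
  have := hti (hmem ⟨y, hy⟩ z hz) (hmem ⟨y', hy'⟩ z' hz') heq
  simpa using this

/-- A tube contains a neighbourhood of each point of the curve. -/
theorem tube_mem_nhds (hC : IsSmoothCurve C) (hh : IsUnitNormalField C h) {δ : ℝ} (hδ : 0 < δ)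
    {p : Plane} (hp : p ∈ C) : tubeMap h '' (C ×ˢ Icc (-δ) δ) ∈ 𝓝 p := by
  obtain ⟨χ⟩ := exists_curveChart hC hp
  have hpW : p ∈ C ∩ χ.W := ⟨hp, χ.mem_W⟩
  have hu := χ.ρ_mem hpW
  have hmap := (χ.tube_injOn_nhds hh hu).2
  rw [χ.γ_ρ hpW] at hmap
  rw [← hmap]
  have hc : ∀ i : Fin 2, Continuous fun x : Plane => x i := fun i =>
    (EuclideanSpace.proj (𝕜 := ℝ) i).continuous
  have hN : {x : Plane | x 0 ∈ χ.J ∧ x 1 ∈ Ioo (-δ) δ} ∈ 𝓝 (!₂[χ.ρ p, 0] : Plane) := by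
    refine ((χ.isOpen_J.preimage (hc 0)).inter (isOpen_Ioo.preimage (hc 1))).mem_nhds ⟨?_, ?_⟩
    · simpa using hu
    · simpa using hδ
  refine mem_of_superset (image_mem_map hN) ?_
  rintro _ ⟨x, ⟨hx0, hx1⟩, rfl⟩
  exact ⟨(χ.γ (x 0), x 1), ⟨(χ.γ_mem hx0).1, Ioo_subset_Icc_self hx1⟩, rfl⟩

theorem continuousOn_tubeMap (hh : IsUnitNormalField C h) (I : Set ℝ) :
    ContinuousOn (tubeMap h) (C ×ˢ I) := by
  have : ContinuousOn (fun q : Plane × ℝ => h q.1) (C ×ˢ I) :=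
    hh.continuousOn.comp continuousOn_fst fun q hq => hq.1
  exact continuousOn_fst.add (continuousOn_snd.smul this)

theorem isCompact_tube (hcomp : IsCompact C) (hh : IsUnitNormalField C h) (δ : ℝ) :
    IsCompact (tubeMap h '' (C ×ˢ Icc (-δ) δ)) :=
  (hcomp.prod isCompact_Icc).image_of_continuousOn (continuousOn_tubeMap hh _)

theorem hausdorffMeasure_lt_top (hC : IsSmoothCurve C) (hcomp : IsCompact C) :
    Measure.hausdorffMeasure 1 C < ⊤ := by
  refine hcomp.measure_lt_top_of_nhdsWithin fun p hp => ?_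
  obtain ⟨χ⟩ := exists_curveChart hC hp
  have hpW : p ∈ C ∩ χ.W := ⟨hp, χ.mem_W⟩
  have hu := χ.ρ_mem hpW
  obtain ⟨ε, hε, hball⟩ := Metric.nhds_basis_closedBall.mem_iff.1 (χ.isOpen_J.mem_nhds hu)
  set K := Metric.closedBall (χ.ρ p) ε with hK
  have hKm : MeasurableSet K := Metric.isClosed_closedBall.measurableSet
  refine ⟨χ.ρ ⁻¹' K ∩ (C ∩ χ.W), ?_, ?_⟩
  · refine inter_mem (mem_nhdsWithin_of_mem_nhds (χ.continuous_ρ.continuousAt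
      (Metric.closedBall_mem_nhds _ hε))) (inter_mem self_mem_nhdsWithin
        (mem_nhdsWithin_of_mem_nhds (χ.isOpen_W.mem_nhds χ.mem_W)))
  · have h1 : Measure.hausdorffMeasure 1 (χ.ρ ⁻¹' K ∩ (C ∩ χ.W)) = χ.arcMeasure K := by
      rw [CurveChart.arcMeasure, Measure.map_apply χ.continuous_ρ.measurable hKm,
        Measure.restrict_apply (χ.continuous_ρ.measurable hKm)]
    rw [h1, χ.arcMeasure_eq, withDensity_apply _ hKm, Measure.restrict_restrict_of_subset hball]
    exact ((χ.continuousOn_deriv.mono hball).norm.integrableOn_compact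
      (isCompact_closedBall _ _)).lintegral_lt_top

/-- Change of variables to normal coordinates over a piece of the curve in one chart. -/
theorem lintegral_tube_of_chart (hh : IsUnitNormalField C h) {p : Plane}
    (χ : CurveChart C p) {δ : ℝ} (hinj : InjOn (tubeMap h) (C ×ˢ Icc (-δ) δ))
    (hκ : ∀ y ∈ C, ∀ z ∈ Icc (-δ) δ, 0 ≤ 1 + z * kappa h y) {f : Plane → ENNReal}
    (hf : Measurable f) {A : Set Plane} (hA : MeasurableSet A) (hAC : A ⊆ C ∩ χ.W) :
    ∫⁻ x in tubeMap h '' (A ×ˢ Icc (-δ) δ), f x =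
      ∫⁻ y in A, ∫⁻ z in Icc (-δ) δ, f (y + z • h y) * ENNReal.ofReal (1 + z * kappa h y)
        ∂volume ∂(Measure.hausdorffMeasure 1) := by
  set I := Icc (-δ) δ with hI
  have hIm : MeasurableSet I := measurableSet_Icc
  set s := χ.ρ '' A with hs
  have hρinj : InjOn χ.ρ A := fun x hx x' hx' hxx => by
    rw [← χ.γ_ρ (hAC hx), hxx, χ.γ_ρ (hAC hx')]
  have hsm : MeasurableSet s := hA.image_of_continuousOn_injOn χ.continuous_ρ.continuousOn hρinj
  have hsJ : s ⊆ χ.J := by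
    rintro _ ⟨x, hx, rfl⟩
    exact χ.ρ_mem (hAC hx)
  have hγs : ∀ u ∈ s, χ.γ u ∈ A := by
    rintro _ ⟨x, hx, rfl⟩
    rwa [χ.γ_ρ (hAC hx)]
  -- the right-hand side in the chart
  set g : ℝ × ℝ → ENNReal := fun q =>
    f (χ.γ q.1 + q.2 • h (χ.γ q.1)) * ENNReal.ofReal (1 + q.2 * kappa h (χ.γ q.1)) with hg
  have hγc : ContinuousOn (fun q : ℝ × ℝ => χ.γ q.1) (s ×ˢ I) :=
    χ.continuousOn_γ.comp continuousOn_fst fun q hq => hsJ hq.1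
  have hγC : MapsTo (fun q : ℝ × ℝ => χ.γ q.1) (s ×ˢ I) C := fun q hq =>
    (hAC (hγs _ hq.1)).1
  have hgm : AEMeasurable g ((volume.restrict s).prod (volume.restrict I)) := by
    rw [Measure.prod_restrict]
    refine AEMeasurable.mul (hf.comp_aemeasurable ?_)
      (ENNReal.measurable_ofReal.comp_aemeasurable ?_)
    · exact (hγc.add (continuousOn_snd.smul (hh.continuousOn.comp hγc hγC))).aemeasurable
        (hsm.prod hIm)
    · exact (continuousOn_const.add (continuousOn_snd.mul
        (hh.continuousOn_kappa.comp hγc hγC))).aemeasurable (hsm.prod hIm)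
  set G : ℝ → ENNReal := fun u => ∫⁻ z in I, g (u, z) with hG
  have hGm : AEMeasurable G (volume.restrict s) := hgm.lintegral_prod_right'
  have hright : ∫⁻ y in A, ∫⁻ z in I, f (y + z • h y) * ENNReal.ofReal (1 + z * kappa h y)
        ∂volume ∂(Measure.hausdorffMeasure 1) =
      ∫⁻ u in s, ENNReal.ofReal ‖deriv χ.γ u‖ * G u := by
    have h1 : ∫⁻ y in A, ∫⁻ z in I, f (y + z • h y) * ENNReal.ofReal (1 + z * kappa h y)
        ∂volume ∂(Measure.hausdorffMeasure 1) =
        ∫⁻ y in A, G (χ.ρ y) ∂(Measure.hausdorffMeasure 1) := by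
      refine setLIntegral_congr_fun hA fun y hy => ?_
      simp only [hG, hg, χ.γ_ρ (hAC hy)]
    have h2 : A = χ.ρ ⁻¹' s ∩ (C ∩ χ.W) := by
      ext x
      refine ⟨fun hx => ⟨mem_image_of_mem _ hx, hAC hx⟩, fun ⟨hx, hx'⟩ => ?_⟩
      have := hγs _ hx
      rwa [χ.γ_ρ hx'] at this
    have h3 : ((Measure.hausdorffMeasure 1).restrict A).map χ.ρ = χ.arcMeasure.restrict s := by
      rw [CurveChart.arcMeasure, Measure.restrict_map χ.continuous_ρ.measurable hsm,
        Measure.restrict_restrict (χ.continuous_ρ.measurable hsm), ← h2]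
    have h4 : χ.arcMeasure.restrict s =
        (volume.restrict s).withDensity fun u => ENNReal.ofReal ‖deriv χ.γ u‖ := by
      rw [χ.arcMeasure_eq, restrict_withDensity hsm, Measure.restrict_restrict_of_subset hsJ]
    rw [h1, ← lintegral_map' (f := G) _ χ.continuous_ρ.aemeasurable, h3, h4,
      lintegral_withDensity_eq_lintegral_mul₀ _ hGm]
    · rfl
    · exact (measurable_deriv χ.γ).norm.ennreal_ofReal.aemeasurable
    · rw [h3, h4]
      exact hGm.mono_ac (withDensity_absolutelyContinuous _ _)
  -- the left-hand side in the chart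
  set m : Plane → ℝ × ℝ := fun x => (x 0, x 1) with hm
  have hmp : MeasurePreserving m volume volume :=
    (volume_preserving_finTwoArrow ℝ).comp (PiLp.volume_preserving_ofLp (Fin 2))
  have hme : MeasurableEmbedding m :=
    MeasurableEquiv.finTwoArrow.measurableEmbedding.comp
      (MeasurableEquiv.toLp 2 (Fin 2 → ℝ)).symm.measurableEmbedding
  have hSm : MeasurableSet (m ⁻¹' (s ×ˢ I)) := hme.measurable (hsm.prod hIm)
  have himage : tubeMap h '' (A ×ˢ I) = χ.tube h '' (m ⁻¹' (s ×ˢ I)) := by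
    ext x
    constructor
    · rintro ⟨q, hq, rfl⟩
      refine ⟨!₂[χ.ρ q.1, q.2], ?_, (χ.tubeMap_eq (hAC hq.1)).symm⟩
      exact ⟨mem_image_of_mem _ hq.1, hq.2⟩
    · rintro ⟨w, hw, rfl⟩
      exact ⟨(χ.γ (w 0), w 1), ⟨hγs _ hw.1, hw.2⟩, rfl⟩
  have hinj' : InjOn (χ.tube h) (m ⁻¹' (s ×ˢ I)) := by
    intro w hw w' hw' hww
    have hmem : (χ.γ (w 0), w 1) ∈ C ×ˢ I := ⟨(hAC (hγs _ hw.1)).1, hw.2⟩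
    have hmem' : (χ.γ (w' 0), w' 1) ∈ C ×ˢ I := ⟨(hAC (hγs _ hw'.1)).1, hw'.2⟩
    have h1 := hinj hmem hmem' hww
    have hw0 : w 0 ∈ χ.J := hsJ hw.1
    have hw0' : w' 0 ∈ χ.J := hsJ hw'.1
    have h2 : χ.ρ (χ.γ (w 0)) = χ.ρ (χ.γ (w' 0)) := congrArg χ.ρ (congrArg Prod.fst h1)
    rw [χ.ρ_γ hw0, χ.ρ_γ hw0'] at h2
    have h3 : w 1 = w' 1 := congrArg Prod.snd h1
    ext i
    fin_cases i
    · exact h2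
    · exact h3
  have hder := fun (x : Plane) (hx : x 0 ∈ χ.J) => χ.exists_tube_hasFDerivAt hh hx
  choose! D hD hDdet using hder
  have hleft : ∫⁻ x in tubeMap h '' (A ×ˢ I), f x =
      ∫⁻ q in s ×ˢ I, ENNReal.ofReal ‖deriv χ.γ q.1‖ * g q := by
    rw [himage, lintegral_image_eq_lintegral_abs_det_fderiv_mul volume hSm
      (fun x hx => (hD x (hsJ hx.1)).hasFDerivWithinAt) hinj', ←
      hmp.setLIntegral_comp_preimage_emb hme]
    refine setLIntegral_congr_fun hSm fun x hx => ?_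
    have hpos := hκ _ (hAC (hγs _ hx.1)).1 _ hx.2
    simp only [hm] at hpos
    simp only [hDdet x (hsJ hx.1), hg, hm, abs_of_nonneg hpos,
      ENNReal.ofReal_mul (norm_nonneg _), CurveChart.tube]
    ring
  rw [hleft, hright, Measure.volume_eq_prod, ← Measure.prod_restrict, lintegral_prod]
  · refine lintegral_congr fun u => ?_
    exact lintegral_const_mul' (ENNReal.ofReal ‖deriv χ.γ u‖) (fun z => g (u, z))
      ENNReal.ofReal_ne_top
  · refine AEMeasurable.mul ?_ hgm
    exact ((measurable_deriv χ.γ).norm.ennreal_ofReal.comp measurable_fst).aemeasurable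

/-- The area element in normal coordinates is `(1 + z κ) dy dz`. -/
theorem lintegral_tube (hC : IsSmoothCurve C) (hcomp : IsCompact C) (hh : IsUnitNormalField C h)
    {δ : ℝ} (hinj : InjOn (tubeMap h) (C ×ˢ Icc (-δ) δ))
    (hκ : ∀ y ∈ C, ∀ z ∈ Icc (-δ) δ, 0 ≤ 1 + z * kappa h y) {f : Plane → ENNReal}
    (hf : Measurable f) :
    ∫⁻ x in tubeMap h '' (C ×ˢ Icc (-δ) δ), f x =
      ∫⁻ y in C, ∫⁻ z in Icc (-δ) δ, f (y + z • h y) * ENNReal.ofReal (1 + z * kappa h y)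
        ∂volume ∂(Measure.hausdorffMeasure 1) := by
  -- the formula is additive in the piece of the curve, so finitely many charts suffice
  set G : Plane → ENNReal := fun y =>
    ∫⁻ z in Icc (-δ) δ, f (y + z • h y) * ENNReal.ofReal (1 + z * kappa h y) with hG
  have key : ∃ B, C ⊆ B ∧ MeasurableSet B ∧ ∀ A ⊆ C ∩ B, MeasurableSet A →
      ∫⁻ x in tubeMap h '' (A ×ˢ Icc (-δ) δ), f x =
        ∫⁻ y in A, G y ∂(Measure.hausdorffMeasure 1) := by
    refine hcomp.induction_on (p := fun s => ∃ B, s ⊆ B ∧ MeasurableSet B ∧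
      ∀ A ⊆ C ∩ B, MeasurableSet A → ∫⁻ x in tubeMap h '' (A ×ˢ Icc (-δ) δ), f x =
        ∫⁻ y in A, G y ∂(Measure.hausdorffMeasure 1)) ?_ ?_ ?_ ?_
    · refine ⟨∅, le_rfl, MeasurableSet.empty, fun A hA _ => ?_⟩
      have : A = ∅ := by simpa using hA
      simp [this]
    · rintro s t hst ⟨B, htB, H⟩
      exact ⟨B, hst.trans htB, H⟩
    · rintro s₁ s₂ ⟨B₁, h₁, hm₁, H₁⟩ ⟨B₂, h₂, hm₂, H₂⟩
      refine ⟨B₁ ∪ B₂, union_subset_union h₁ h₂, hm₁.union hm₂, fun A hA hAm => ?_⟩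
      have hAC : A ⊆ C := fun x hx => (hA hx).1
      have hA2 : A \ B₁ ⊆ C ∩ B₂ := fun x hx => ⟨hAC hx.1, (hA hx.1).2.resolve_left hx.2⟩
      have hA1 : A ∩ B₁ ⊆ C ∩ B₁ := inter_subset_inter_left _ hAC
      have hdisj : Disjoint (A ∩ B₁) (A \ B₁) := disjoint_sdiff_inter.symm
      have hsub : ∀ A' ⊆ A, A' ×ˢ Icc (-δ) δ ⊆ C ×ˢ Icc (-δ) δ := fun A' h =>
        prod_mono_left (h.trans hAC)
      have hdm : MeasurableSet (tubeMap h '' ((A \ B₁) ×ˢ Icc (-δ) δ)) :=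
        ((hAm.diff hm₁).prod measurableSet_Icc).image_of_continuousOn_injOn
          ((continuousOn_tubeMap hh _).mono (hsub _ sdiff_subset)) (hinj.mono (hsub _ sdiff_subset))
      have hdi : Disjoint (tubeMap h '' ((A ∩ B₁) ×ˢ Icc (-δ) δ))
          (tubeMap h '' ((A \ B₁) ×ˢ Icc (-δ) δ)) :=
        disjoint_image_image fun q hq q' hq' heq => by
          have := hinj (hsub _ inter_subset_left hq) (hsub _ sdiff_subset hq') heq
          exact hq'.1.2 (this ▸ hq.1.2)
      rw [← inter_union_sdiff A B₁, union_prod, image_union, lintegral_union hdm hdi,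
        lintegral_union (hAm.diff hm₁) hdisj, H₁ _ hA1 (hAm.inter hm₁), H₂ _ hA2 (hAm.diff hm₁)]
    · intro p hp
      obtain ⟨χ⟩ := exists_curveChart hC hp
      exact ⟨χ.W, mem_nhdsWithin_of_mem_nhds (χ.isOpen_W.mem_nhds χ.mem_W), χ.W, le_rfl,
        χ.isOpen_W.measurableSet, fun A hA hAm => lintegral_tube_of_chart hh χ hinj hκ hf hAm hA⟩
  obtain ⟨B, hCB, -, H⟩ := key
  exact H C (subset_inter le_rfl hCB) hcomp.measurableSet

end Tube

/-! ### Away from the curve -/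

section

variable {Φ h : Plane → Plane} {C : Set Plane}

theorem displacement_nonneg (Φ : Plane → Plane) (x : Plane) : 0 ≤ displacement Φ x := by
  rw [displacement, worldFunction]; positivity

theorem displacement_pos {x : Plane} (hx : x ∉ Function.fixedPoints Φ) :
    0 < displacement Φ x := by
  have h1 : x - Φ x ≠ 0 := fun h0 => hx (sub_eq_zero.1 h0).symm
  have := norm_pos_iff.2 h1
  rw [displacement, worldFunction]; positivity

theorem worldFunction_zero (x : Plane) : worldFunction x 0 = ‖x‖ ^ 2 / 2 := by
  rw [worldFunction, zero_sub, norm_neg]; ring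

theorem integrable_exp_neg_displacement (hΦ : ContDiff ℝ ∞ Φ)
    (hgrowth : ∃ p R K : ℝ, 0 < p ∧ 0 < R ∧ 0 < K ∧ ∀ x : Plane,
      R ^ 2 / 2 < worldFunction x 0 → K * worldFunction x 0 ^ p ≤ displacement Φ x)
    {c : ℝ} (hc : 0 < c) : Integrable fun x => Real.exp (-(c * displacement Φ x)) := by
  obtain ⟨p, R, K, hp, hR, hK, H⟩ := hgrowth
  have hcont : Continuous fun x => Real.exp (-(c * displacement Φ x)) := by
    have := (contDiff_displacement hΦ).continuous
    fun_prop
  have hg : Integrable fun x : Plane => (1 + ‖x‖) ^ (-(3 : ℝ)) := by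
    refine integrable_one_add_norm ?_
    norm_num
  refine hcont.locallyIntegrable.integrable_of_isBigO_cocompact ?_ (hg.integrableAtFilter _)
  set k := c * (K / 2 ^ p) with hk
  have hk0 : 0 < k := by positivity
  have h1 : (fun r : ℝ => Real.exp (-k * r ^ (2 * p))) =O[atTop]
      fun r : ℝ => (r ^ (2 * p)) ^ (-(3 / (2 * p))) :=
    ((isLittleO_exp_neg_mul_rpow_atTop hk0 _).comp_tendsto
      (tendsto_rpow_atTop (by positivity : 0 < 2 * p))).isBigO
  have h2 : (fun r : ℝ => (r ^ (2 * p)) ^ (-(3 / (2 * p)))) =O[atTop]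
      fun r : ℝ => (1 + r) ^ (-(3 : ℝ)) := by
    refine Asymptotics.IsBigO.of_bound 8 ?_
    filter_upwards [eventually_ge_atTop 1] with r hr
    have hr0 : 0 < r := by linarith
    rw [← Real.rpow_mul hr0.le, show 2 * p * -(3 / (2 * p)) = -3 by field_simp,
      Real.norm_of_nonneg (by positivity), Real.norm_of_nonneg (by positivity),
      Real.rpow_neg hr0.le, Real.rpow_neg (by positivity)]
    have h8 : (1 + r) ^ (3 : ℝ) ≤ 8 * r ^ (3 : ℝ) := by
      have : (8 : ℝ) = 2 ^ (3 : ℝ) := by norm_num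
      rw [this, ← Real.mul_rpow (by norm_num) hr0.le]
      exact Real.rpow_le_rpow (by positivity) (by linarith) (by norm_num)
    rw [← div_eq_mul_inv, inv_eq_one_div, div_le_div_iff₀ (by positivity) (by positivity)]
    linarith
  have h3 := (h1.trans h2).comp_tendsto (tendsto_norm_cocompact_atTop (E := Plane))
  refine Asymptotics.IsBigO.trans (Asymptotics.IsBigO.of_bound 1 ?_) h3
  filter_upwards [(tendsto_norm_cocompact_atTop (E := Plane)).eventually_gt_atTop R] with x hx
  rw [Real.norm_of_nonneg (Real.exp_pos _).le, one_mul, Function.comp_apply,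
    Real.norm_of_nonneg (Real.exp_pos _).le, Real.exp_le_exp, neg_mul, neg_le_neg_iff, hk]
  have h4 : K * worldFunction x 0 ^ p ≤ displacement Φ x := H x (by
    rw [worldFunction_zero]
    gcongr)
  have h5 : worldFunction x 0 ^ p = ‖x‖ ^ (2 * p) / 2 ^ p := by
    rw [worldFunction_zero, Real.div_rpow (by positivity) (by norm_num), ← Real.rpow_natCast,
      ← Real.rpow_mul (norm_nonneg x)]
    norm_num
  rw [h5] at h4
  calc c * (K / 2 ^ p) * ‖x‖ ^ (2 * p) = c * (K * (‖x‖ ^ (2 * p) / 2 ^ p)) := by ring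
    _ ≤ _ := by gcongr

/-- Off a neighbourhood of the fixed point set, `S` is bounded below: by compactness near the
origin, and by the growth condition far away. -/
theorem exists_displacement_ge (hΦ : ContDiff ℝ ∞ Φ)
    (hgrowth : ∃ p R K : ℝ, 0 < p ∧ 0 < R ∧ 0 < K ∧ ∀ x : Plane,
      R ^ 2 / 2 < worldFunction x 0 → K * worldFunction x 0 ^ p ≤ displacement Φ x)
    {T : Set Plane} (hT : ∀ p ∈ Function.fixedPoints Φ, T ∈ 𝓝 p) :
    ∃ c > 0, ∀ x ∉ T, c ≤ displacement Φ x := by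
  obtain ⟨p, R, K, hp, hR, hK, H⟩ := hgrowth
  have hcomp : IsCompact (Metric.closedBall (0 : Plane) R ∩ (interior T)ᶜ) :=
    (isCompact_closedBall _ _).inter_right isOpen_interior.isClosed_compl
  obtain ⟨c, hc, hmin⟩ := hcomp.exists_forall_le' (a := 0)
    (contDiff_displacement hΦ).continuous.continuousOn fun x hx =>
      displacement_pos fun hfix => hx.2 (mem_interior_iff_mem_nhds.2 (hT x hfix))
  refine ⟨min c (K * (R ^ 2 / 2) ^ p), by positivity, fun x hx => ?_⟩
  by_cases hxR : ‖x‖ ≤ R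
  · exact (min_le_left _ _).trans
      (hmin x ⟨mem_closedBall_zero_iff.2 hxR, fun hi => hx (interior_subset hi)⟩)
  · push Not at hxR
    have h1 : R ^ 2 / 2 < worldFunction x 0 := by
      rw [worldFunction_zero]; gcongr
    refine (min_le_right _ _).trans (le_trans ?_ (H x h1))
    gcongr

theorem integrable_deformedHeatKernel (hΦ : ContDiff ℝ ∞ Φ)
    (hgrowth : ∃ p R K : ℝ, 0 < p ∧ 0 < R ∧ 0 < K ∧ ∀ x : Plane,
      R ^ 2 / 2 < worldFunction x 0 → K * worldFunction x 0 ^ p ≤ displacement Φ x)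
    {t : ℝ} (ht : 0 < t) : Integrable fun x => deformedHeatKernel Φ t x x := by
  have := (integrable_exp_neg_displacement hΦ hgrowth (c := (2 * t)⁻¹) (by positivity)).const_mul
    (4 * π * t)⁻¹
  refine this.congr (ae_of_all _ fun x => ?_)
  simp only [deformedHeatKernel_self]
  rw [div_eq_inv_mul]

/-- The region off the tube contributes less than any power of `t`. -/
theorem isBigO_integral_compl (hΦ : ContDiff ℝ ∞ Φ)
    (hgrowth : ∃ p R K : ℝ, 0 < p ∧ 0 < R ∧ 0 < K ∧ ∀ x : Plane,
      R ^ 2 / 2 < worldFunction x 0 → K * worldFunction x 0 ^ p ≤ displacement Φ x)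
    {T : Set Plane} (hTm : MeasurableSet T) (hT : ∀ p ∈ Function.fixedPoints Φ, T ∈ 𝓝 p) (r : ℝ) :
    (fun t => ∫ x in Tᶜ, deformedHeatKernel Φ t x x) =O[𝓝[>] 0] fun t : ℝ => t ^ r := by
  obtain ⟨c, hc, hcT⟩ := exists_displacement_ge hΦ hgrowth hT
  set I := ∫ x in Tᶜ, Real.exp (-(1 / 4 * displacement Φ x)) with hI
  have hint := (integrable_exp_neg_displacement hΦ hgrowth (c := 1 / 4) (by norm_num)).integrableOn
    (s := Tᶜ)
  have h1 : (fun t => ∫ x in Tᶜ, deformedHeatKernel Φ t x x) =O[𝓝[>] 0]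
      fun t : ℝ => t⁻¹ * Real.exp (-(c / 4) * t⁻¹) := by
    refine Asymptotics.IsBigO.of_bound ((4 * π)⁻¹ * I) ?_
    filter_upwards [Ioo_mem_nhdsGT one_pos] with t ht
    have ht0 := ht.1
    rw [Real.norm_of_nonneg (by positivity : 0 ≤ t⁻¹ * Real.exp (-(c / 4) * t⁻¹))]
    -- one half of the exponent gives the decay in `t`, the other half the integrability in `x`
    have h2 : ‖∫ x in Tᶜ, deformedHeatKernel Φ t x x‖ ≤ ∫ x in Tᶜ,
        ((4 * π)⁻¹ * (t⁻¹ * Real.exp (-(c / 4) * t⁻¹))) *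
          Real.exp (-(1 / 4 * displacement Φ x)) := by
      refine norm_integral_le_of_norm_le (hint.const_mul _) ?_
      filter_upwards [ae_restrict_mem hTm.compl] with x hx
      rw [deformedHeatKernel_self, Real.norm_of_nonneg (by positivity), mul_inv,
        mul_assoc, mul_assoc, mul_assoc, ← Real.exp_add]
      gcongr
      have h3 := hcT x hx
      have h4 := displacement_nonneg Φ x
      have h5 : 1 ≤ t⁻¹ := (one_le_inv₀ ht0).2 ht.2.le
      have h6 : displacement Φ x / (2 * t) = displacement Φ x * t⁻¹ / 2 := by
        field_simp
      rw [h6]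
      nlinarith
    refine h2.trans (le_of_eq ?_)
    rw [integral_const_mul]
    ring
  refine h1.trans ?_
  have h2 := ((isLittleO_exp_neg_mul_rpow_atTop (a := c / 4) (by positivity)
    (-(r + 1))).comp_tendsto tendsto_inv_nhdsGT_zero).isBigO
  have h3 := (Asymptotics.isBigO_refl (fun t : ℝ => t⁻¹) (𝓝[>] 0)).mul h2
  refine h3.congr' (Eventually.of_forall fun t => rfl) ?_
  filter_upwards [self_mem_nhdsWithin] with t ht
  have ht0 : 0 < t := ht
  simp only [Function.comp_apply]
  rw [Real.inv_rpow ht0.le, Real.rpow_neg ht0.le, inv_inv, Real.rpow_add ht0, Real.rpow_one]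
  field_simp

/-! ### Assembling the expansion -/

theorem integrableOn_of_continuousOn (hC : IsSmoothCurve C) (hcomp : IsCompact C) {f : Plane → ℝ}
    (hf : ContinuousOn f C) : IntegrableOn f C (Measure.hausdorffMeasure 1) := by
  obtain ⟨M, hM⟩ := hcomp.exists_bound_of_continuousOn hf
  have : IsFiniteMeasure ((Measure.hausdorffMeasure 1).restrict C : Measure Plane) := ⟨by
    rw [Measure.restrict_apply_univ]; exact hausdorffMeasure_lt_top hC hcomp⟩
  refine Integrable.of_bound (hf.aestronglyMeasurable hcomp.measurableSet) M ?_
  filter_upwards [ae_restrict_mem hcomp.measurableSet] with y hy using hM y hy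

theorem continuousOn_integral_normalIntegrand (hΦ : ContDiff ℝ ∞ Φ) (hcomp : IsCompact C)
    (hh : IsUnitNormalField C h) (t δ : ℝ) :
    ContinuousOn (fun y => ∫ z in Icc (-δ) δ, normalIntegrand Φ h t y z) C := by
  have : CompactSpace C := isCompact_iff_compactSpace.1 hcomp
  rw [continuousOn_iff_continuous_domRestrict]
  refine continuous_parametric_integral_of_continuous
    (f := fun (y : C) (z : ℝ) => normalIntegrand Φ h t y z) ?_ isCompact_Icc
  have h1 : Continuous fun y : C => h y := hh.continuousOn.domRestrict
  have h2 : Continuous fun y : C => kappa h y := hh.continuousOn_kappa.domRestrict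
  have h3 : Continuous fun q : C × ℝ => (q.1 : Plane) + q.2 • h q.1 :=
    (continuous_subtype_val.comp continuous_fst).add
      (continuous_snd.smul (h1.comp continuous_fst))
  exact ((continuous_deformedHeatKernel hΦ t).comp h3).mul
    (continuous_const.add (continuous_snd.mul (h2.comp continuous_fst)))

/-- The part of the heat trace coming from the tube, as an integral along the normals. -/
theorem setIntegral_tube (hΦ : ContDiff ℝ ∞ Φ) (hC : IsSmoothCurve C) (hcomp : IsCompact C)
    (hh : IsUnitNormalField C h) {δ : ℝ} (hinj : InjOn (tubeMap h) (C ×ˢ Icc (-δ) δ))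
    (hκ : ∀ y ∈ C, ∀ z ∈ Icc (-δ) δ, 0 ≤ 1 + z * kappa h y) {t : ℝ} (ht : 0 < t) :
    ∫ x in tubeMap h '' (C ×ˢ Icc (-δ) δ), deformedHeatKernel Φ t x x =
      ∫ y in C, ∫ z in Icc (-δ) δ, normalIntegrand Φ h t y z ∂volume
        ∂(Measure.hausdorffMeasure 1) := by
  have hpos : ∀ x, 0 ≤ deformedHeatKernel Φ t x x := fun x => by
    rw [deformedHeatKernel_self]; positivity
  have hnonneg : ∀ y ∈ C, ∀ z ∈ Icc (-δ) δ, 0 ≤ normalIntegrand Φ h t y z := fun y hy z hz =>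
    mul_nonneg (hpos _) (hκ y hy z hz)
  have hcont := continuous_deformedHeatKernel hΦ t
  rw [integral_eq_lintegral_of_nonneg_ae (ae_of_all _ hpos) hcont.aestronglyMeasurable,
    integral_eq_lintegral_of_nonneg_ae (by
      filter_upwards [ae_restrict_mem hcomp.measurableSet] with y hy using
        setIntegral_nonneg measurableSet_Icc (hnonneg y hy))
      ((continuousOn_integral_normalIntegrand hΦ hcomp hh t δ).aestronglyMeasurable
        hcomp.measurableSet),
    lintegral_tube hC hcomp hh hinj hκ
      (f := fun x => ENNReal.ofReal (deformedHeatKernel Φ t x x)) hcont.measurable.ennreal_ofReal]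
  congr 1
  refine setLIntegral_congr_fun hcomp.measurableSet fun y hy => ?_
  rw [ofReal_integral_eq_lintegral_ofReal
    (continuous_normalIntegrand hΦ t y).integrableOn_Icc (by
      filter_upwards [ae_restrict_mem measurableSet_Icc] with z hz using hnonneg y hy z hz)]
  refine lintegral_congr fun z => ?_
  rw [normalIntegrand, ENNReal.ofReal_mul (hpos _)]

/-- The tube contributes the expansion, with an error that is uniform along the curve and hence
survives integration over it; the rest of the plane contributes nothing to any order. -/
theorem isBigO_deformedHeatTrace (hΦ : ContDiff ℝ ∞ Φ) (hfix : C = Function.fixedPoints Φ)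
    (hC : IsSmoothCurve C) (hcomp : IsCompact C)
    (hgrowth : ∃ p R K : ℝ, 0 < p ∧ 0 < R ∧ 0 < K ∧ ∀ x : Plane,
      R ^ 2 / 2 < worldFunction x 0 → K * worldFunction x 0 ^ p ≤ displacement Φ x)
    (hh : IsUnitNormalField C h) (hs2 : ∀ y ∈ C, 0 < s Φ h 2 y) (N : ℕ) :
    (fun t : ℝ => deformedHeatTrace Φ t - ∑ k ∈ Finset.range N, t ^ ((2 * (k : ℝ) - 1) / 2) *
        ∫ y in C, a Φ h k y ∂(Measure.hausdorffMeasure 1))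
      =O[𝓝[>] 0] fun t : ℝ => t ^ ((2 * (N : ℝ) - 1) / 2) := by
  have hsub : C ⊆ Function.fixedPoints Φ := hfix.subset
  obtain ⟨σ, hσ, hσs⟩ := hcomp.exists_forall_le' (a := 0)
    (continuousOn_s hΦ hh.continuousOn 2) hs2
  obtain ⟨δ₁, hδ₁, hrem⟩ := exists_exponentRemainder_le hΦ hcomp hsub hh
    (σ := σ / 8) (by positivity)
  obtain ⟨δ₂, hδ₂, hinj⟩ := exists_injOn_tubeMap hC hcomp hh
  obtain ⟨cκ, hcκ⟩ := hcomp.exists_bound_of_continuousOn hh.continuousOn_kappa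
  set δ := min (min δ₁ δ₂) (1 / (|cκ| + 1)) with hδdef
  have hδ : 0 < δ := by positivity
  have hδ1 : δ ≤ δ₁ := (min_le_left _ _).trans (min_le_left _ _)
  have hδ2 : δ ≤ δ₂ := (min_le_left _ _).trans (min_le_right _ _)
  have hδ3 : δ * (|cκ| + 1) ≤ 1 := (le_div_iff₀ (by positivity)).1 (min_le_right _ _)
  have hinj' : InjOn (tubeMap h) (C ×ˢ Icc (-δ) δ) :=
    hinj.mono (prod_mono_right (Icc_subset_Icc (by linarith) hδ2))
  have hκ : ∀ y ∈ C, ∀ z ∈ Icc (-δ) δ, 0 ≤ 1 + z * kappa h y := by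
    intro y hy z hz
    have h1 : |z * kappa h y| ≤ δ * |cκ| := by
      rw [abs_mul]
      exact mul_le_mul (abs_le.2 hz) ((hcκ y hy).trans (le_abs_self _)) (abs_nonneg _) hδ.le
    have := neg_abs_le (z * kappa h y)
    nlinarith
  obtain ⟨K, hK⟩ := exists_normal_expansion hΦ hcomp hsub hh hσ hσs hδ
    (fun y hy z hz => hrem y hy z (hz.trans hδ1)) N
  set T := tubeMap h '' (C ×ˢ Icc (-δ) δ) with hT
  have hTm : MeasurableSet T := (isCompact_tube hcomp hh δ).measurableSet
  have hTn : ∀ p ∈ Function.fixedPoints Φ, T ∈ 𝓝 p := fun p hp =>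
    tube_mem_nhds hC hh hδ (hfix ▸ hp)
  have hout := isBigO_integral_compl hΦ hgrowth hTm hTn ((2 * (N : ℝ) - 1) / 2)
  set μ : Measure Plane := (Measure.hausdorffMeasure 1).restrict C with hμ
  have : IsFiniteMeasure μ := ⟨by
    rw [hμ, Measure.restrict_apply_univ]; exact hausdorffMeasure_lt_top hC hcomp⟩
  set Jt : ℝ → Plane → ℝ := fun t y => ∫ z in Icc (-δ) δ, normalIntegrand Φ h t y z with hJt
  have hJint : ∀ t, Integrable (Jt t) μ := fun t =>
    integrableOn_of_continuousOn hC hcomp (continuousOn_integral_normalIntegrand hΦ hcomp hh t δ)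
  have haint : ∀ k, Integrable (a Φ h k) μ := fun k =>
    integrableOn_of_continuousOn hC hcomp (continuousOn_a hΦ hh hs2 k)
  have hin : (fun t : ℝ => ∫ y, (Jt t y - ∑ k ∈ Finset.range N,
      t ^ ((2 * (k : ℝ) - 1) / 2) * a Φ h k y) ∂μ)
      =O[𝓝[>] 0] fun t : ℝ => t ^ ((2 * (N : ℝ) - 1) / 2) := by
    refine Asymptotics.IsBigO.of_bound (K * μ.real univ) ?_
    filter_upwards [Ioo_mem_nhdsGT one_pos] with t ht
    have ht0 := ht.1
    refine (norm_integral_le_of_norm_le_const (C := K * t ^ ((2 * (N : ℝ) - 1) / 2)) ?_).trans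
      (le_of_eq ?_)
    · filter_upwards [ae_restrict_mem hcomp.measurableSet] with y hy using hK y hy t ht0 ht.2.le
    · rw [Real.norm_of_nonneg (by positivity)]; ring
  refine (hin.add hout).congr' ?_ EventuallyEq.rfl
  filter_upwards [self_mem_nhdsWithin] with t ht
  have ht0 : 0 < t := ht
  have hsum : Integrable (fun y => ∑ k ∈ Finset.range N,
      t ^ ((2 * (k : ℝ) - 1) / 2) * a Φ h k y) μ :=
    integrable_finsetSum _ fun k _ => (haint k).const_mul _
  rw [integral_sub (hJint t) hsum, integral_finsetSum _ fun k _ => (haint k).const_mul _,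
    deformedHeatTrace, ← integral_add_compl hTm (integrable_deformedHeatKernel hΦ hgrowth ht0),
    setIntegral_tube hΦ hC hcomp hh hinj' hκ ht0]
  simp only [integral_const_mul]
  ring

end

end DeformedHeat

theorem mainTheorem5
    (Φ : DeformedHeat.Plane → DeformedHeat.Plane) (hΦ : ContDiff ℝ ∞ Φ)
    -- the fixed point set is a smooth compact connected curve
    (C : Set DeformedHeat.Plane) (hC : C = Function.fixedPoints Φ)
    (hsmooth : DeformedHeat.IsSmoothCurve C) (hcompact : IsCompact C) (hconn : IsConnected C)
    -- growth at infinity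
    (hgrowth : ∃ p R K : ℝ, 0 < p ∧ 0 < R ∧ 0 < K ∧ ∀ x : DeformedHeat.Plane,
      R ^ 2 / 2 < DeformedHeat.worldFunction x 0 →
        K * DeformedHeat.worldFunction x 0 ^ p ≤ DeformedHeat.displacement Φ x)
    (h : DeformedHeat.Plane → DeformedHeat.Plane) (hh : DeformedHeat.IsUnitNormalField C h)
    -- non-degeneracy
    (hs2 : ∀ y ∈ C, 0 < DeformedHeat.s Φ h 2 y) :
    -- the `a_k` are the local coefficients of the expansion of the deformed heat trace
    ((∀ t : ℝ, 0 < t → Integrable (fun x => DeformedHeat.deformedHeatKernel Φ t x x)) ∧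
      (∀ k : ℕ, ∀ y ∈ C, Integrable (DeformedHeat.aIntegrand Φ h k y)) ∧
      (∀ k : ℕ, IntegrableOn (DeformedHeat.a Φ h k) C (Measure.hausdorffMeasure 1)) ∧
      ∀ N : ℕ,
        (fun t : ℝ => DeformedHeat.deformedHeatTrace Φ t -
          ∑ k ∈ Finset.range N, t ^ ((2 * (k : ℝ) - 1) / 2) *
            ∫ y in C, DeformedHeat.a Φ h k y ∂(Measure.hausdorffMeasure 1))
        =O[𝓝[>] 0] fun t : ℝ => t ^ ((2 * (N : ℝ) - 1) / 2)) ∧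
    -- the explicit values
    ∀ y ∈ C, ∀ κ s₂ s₃ s₄ s₅ s₆ : ℝ, κ = DeformedHeat.kappa h y →
      s₂ = DeformedHeat.s Φ h 2 y → s₃ = DeformedHeat.s Φ h 3 y →
      s₄ = DeformedHeat.s Φ h 4 y → s₅ = DeformedHeat.s Φ h 5 y →
      s₆ = DeformedHeat.s Φ h 6 y →
      ∀ ψ : ℕ → DeformedHeat.Plane, (∀ k, ψ k = DeformedHeat.psi Φ h k y) →
      DeformedHeat.a Φ h 0 y = (4 * π * s₂) ^ (-(1 / 2) : ℝ) ∧
      DeformedHeat.a Φ h 1 y = (4 * π * s₂) ^ (-(1 / 2) : ℝ) *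
        ((-(s₃ * κ) - 1 / 4 * s₄) * s₂ ^ (-2 : ℤ) + 5 / 12 * s₃ ^ 2 * s₂ ^ (-3 : ℤ)) ∧
      DeformedHeat.a Φ h 2 y = (4 * π * s₂) ^ (-(1 / 2) : ℝ) *
        ((-(1 / 2 * s₅ * κ) - 1 / 12 * s₆) * s₂ ^ (-3 : ℤ)
          + (35 / 12 * s₃ * s₄ * κ + 7 / 12 * s₃ * s₅ + 35 / 96 * s₄ ^ 2) * s₂ ^ (-4 : ℤ)
          + (-(35 / 12 * s₃ ^ 3 * κ) - 35 / 16 * s₃ ^ 2 * s₄) * s₂ ^ (-5 : ℤ)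
          + 385 / 288 * s₃ ^ 4 * s₂ ^ (-6 : ℤ)) ∧
      s₂ = inner ℝ (ψ 1) (ψ 1) ∧
      s₃ = 3 * inner ℝ (ψ 1) (ψ 2) ∧
      s₄ = 4 * inner ℝ (ψ 1) (ψ 3) + 3 * inner ℝ (ψ 2) (ψ 2) ∧
      s₅ = 5 * inner ℝ (ψ 1) (ψ 4) + 10 * inner ℝ (ψ 2) (ψ 3) ∧
      s₆ = 6 * inner ℝ (ψ 1) (ψ 5) + 15 * inner ℝ (ψ 2) (ψ 4) + 10 * inner ℝ (ψ 3) (ψ 3) := by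
  have hfix : C ⊆ Function.fixedPoints Φ := hC.subset
  refine ⟨⟨fun t ht => DeformedHeat.integrable_deformedHeatKernel hΦ hgrowth ht,
    fun k y hy => DeformedHeat.integrable_aIntegrand (hs2 y hy) k,
    fun k => DeformedHeat.integrableOn_of_continuousOn hsmooth hcompact
      (DeformedHeat.continuousOn_a hΦ hh hs2 k),
    fun N => DeformedHeat.isBigO_deformedHeatTrace hΦ hC hsmooth hcompact hgrowth hh hs2 N⟩, ?_⟩
  rintro y hy κ s₂ s₃ s₄ s₅ s₆ rfl rfl rfl rfl rfl rfl ψ hψ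
  exact ⟨DeformedHeat.a_zero_eq (hs2 y hy), DeformedHeat.a_one_eq (hs2 y hy),
    DeformedHeat.a_two_eq (hs2 y hy), DeformedHeat.s_explicit hΦ (hfix hy) hψ⟩
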